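/- **Setting.** A plant $\dot x_p=f_p(x_p,\hat u,w)$ and a controller $\dot x_c=f_c(x_c,\hat x_p)$, $u=g_c(x_c,x_p)$ exchange samples at instants $0=t_0<t_1<\cdots$ with zero-order hold. Let $x=[x_p^\top,x_c^\top]^\top$, $\hat x=[\hat x_p^\top,\hat x_c^\top]^\top$ the values at the last sampling instant, $e=\hat x-x$, $$f(x,e,w)=\begin{bmatrix} f_p(x_p,g_c(x_c+e_{x_c},x_p+e_{x_p}),w)\\ f_c(x_c,x_p+e_{x_p})\end{bmatrix}\ \text{(continuous)},\qquad g=-f .$$ With $\xi=(x,e,\eta,\tau,\tau_{\max})$, $\eta\in\mathbb R$, $\mathcal H_{STC}$ is the hybrid system with flow $\dot\xi=(f(x,e,w),g(x,e,w),0,1,0)$ on $\{\tau\le\tau_{\max}\}$ and jumps $\xi^+=(x,0,S(\eta,x),0,\Gamma(x,\eta))$ on $\{\tau=\tau_{\max}\}$; solutions are hybrid arcs, absolutely continuous between jumps, with $\tau_{\max}(0,0)=\tau(0,0)\ge 0$ (so sampling takes place at time $0$). The disturbance $w$ is locally integrable and $w(t)\in\mathcal W=\{w:|w|\le\bar w\}$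 for all $t\ge0$, where $\bar w>0$. **Local condition.** For $c>0$ put $\mathcal X_c=\{x:V(x)\le c\}$. The condition $\mathrm{A}(c;\epsilon,\gamma,L;V,\alpha_w)$, with $L,\gamma>0$, $\epsilon\in\mathbb R$, says: $V\ge0$ is locally Lipschitz, $\alpha_w\in\mathcal K_\infty$, and there are a locally Lipschitz $W\ge0$, a continuous $H:\mathbb R^{n_x}\times\mathbb R^{n_e}\times\mathcal W\to\mathbb R_{\ge0}$ and $\underline\alpha_W,\overline\alpha_W,\underline\alpha_V,\overline\alpha_V\in\mathcal K_\infty$ with $\underline\alpha_W(|e|)\le W(e)\le\overline\alpha_W(|e|)$ for all $e$ and $\underline\alpha_V(|x|)\le V(x)\le\overline\alpha_V(|x|)$ for all $x$; for all $x\in\mathcal X_c$, $w\in\mathcal W$ and almost all $e$ with $x+e\in\mathcal X_c$, $\langle\nabla W(e),g(x,e,w)\rangle\le LW(e)+H(x,e,w)$; and for all $e$, all $w\in\mathcal W$ and almost all $x\in\mathcal X_c$ with $x+e\in\mathcal X_c$, $\langle\nabla V(x),f(x,e,w)\rangle\le-\epsilon V(x)-H^2(x,e,w)+\gamma^2W^2(e)+\alpha_w(|w|)$.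 **Mechanism.** With $r=\sqrt{|(\gamma/\Lambda)^2-1|}$ let $T_{\max}(\gamma,\Lambda)=\frac{\arctan r}{\Lambda r}$, $\frac1\Lambda$, $\frac{\operatorname{arctanh} r}{\Lambda r}$ if $\gamma>\Lambda$, $\gamma=\Lambda$, $\gamma<\Lambda$, respectively. Let $\epsilon_{\mathrm{ref}}>0$, $\delta\in(0,1)$, $$C(x,\eta)=\max\{\min\{\eta,c_{\max}\},c_w\},\qquad S(\eta,x)=e^{-\epsilon_{\mathrm{ref}}\Gamma(x,\eta)}\big(r_1\eta+r_2V(x)\big).$$ $\Gamma(x,\eta)$ is computed, whenever some $c_l\ge\max\{V(x),C(x,\eta)\}$ exists (elsewhere $\Gamma$ is arbitrary), as follows: take the smallest such index $l$ and set $\bar h=\delta T_{\max}(\gamma_{1,l},L_{1,l}+\epsilon_{1,l}/2)$. For $i=2,\dots,n_{\mathrm{par}}$ let $\Lambda_{i,l}=\max\{L_{i,l}+\epsilon_{i,l}/2,1-\delta\}$ and let $\bar h_i$ be: $0$ if $C<V$; if $C\ge V$ and $\epsilon_{\mathrm{ref}}-\epsilon_{i,l}>0$, $$\bar h_i=\min\Big\{\delta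 T_{\max}(\gamma_{i,l},\Lambda_{i,l}),\ \frac{\log\big(C-\alpha_w(\bar w)/\epsilon_{i,l}\big)-\log\big(V-\alpha_w(\bar w)/\epsilon_{i,l}\big)}{\epsilon_{\mathrm{ref}}-\epsilon_{i,l}}\Big\};$$ and $\bar h_i=\delta T_{\max}(\gamma_{i,l},\Lambda_{i,l})$ otherwise. If $\bar h_i>\bar h$, replace $\bar h$ by $\bar h_i$. Finally $\Gamma(x,\eta)=\bar h$. **Theorem.** Let $n_c,n_{\mathrm{par}}\ge1$, let $c_l>0$ for $l=1,\dots,n_c$, and suppose that $\mathrm A(c_l;\epsilon_{i,l},\gamma_{i,l},L_{i,l};V,\alpha_w)$ holds for all $i\le n_{\mathrm{par}}$, $l\le n_c$, with the same $V$ and $\alpha_w$. Let $\epsilon_{1,l}>0$ and $\epsilon_{i,l}<0$ for $i>1$ and each $l$, let $c_{\max}\ge c_w\ge\max_l\alpha_w(\bar w)/\epsilon_{1,l}$ and $c_{\max}\le\max_lc_l$, and let $r_1,r_2>0$, $r_1+r_2\le1$. If $c_{\max}=\max_lc_l$, suppose moreover that $\alpha_w(\bar w)/\epsilon_{1,l}<c_{\max}$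 for all $l$ (automatic if $c_w<c_{\max}$) and that $\{V\le c_{\max}\}$ is the closure of $\{V<c_{\max}\}$. Put $t_{\min}=\min_l\delta T_{\max}(\gamma_{1,l},L_{1,l}+\epsilon_{1,l}/2)$. Then: 1. $t_{\min}>0$; $\Gamma(x,\eta)\ge t_{\min}$ wherever the algorithm can be executed; and $t_{j+1}-t_j\ge t_{\min}$ for all sampling instants of each solution of $\mathcal H_{STC}$ with $V(x(0,0))\le c_{\max}$; 2. $\mathcal R=\{V(x)\le c_w\}$ is robustly asymptotically stable with region of attraction $\mathcal X_{c_{\max}}$: there is $\beta\in\mathcal{KLL}$ such that, for all disturbances $w$ as above and all solutions with $V(x(0,0))\le c_{\max}$ and arbitrary $e(0,0),\eta(0,0)$, $$V(x(t,j))\le c_w+\beta\Big(\max\{V(x(0,0))-c_w,0\}+\left|\begin{bmatrix}e(0,0)\\\eta(0,0)\end{bmatrix}\right|,t,j\Big)$$ for all $(t,j)$ in the domain of the solution. Here $\beta:\mathbb R_{\ge0}^3\to\mathbb R_{\ge0}$ is of class $\mathcal{KLL}$ if for each $r\ge 0$ both $\beta(\cdot,r,\cdot)$ and $\beta(\cdot,\cdot,r)$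 are of class $\mathcal{KL}$. -/

import Mathlib

open Set Filter Topology MeasureTheory

/-! ## Comparison functions -/

/-- Class `𝒦`: continuous, strictly increasing on `[0, ∞)`, and zero at zero. -/
def IsClassK (α : ℝ → ℝ) : Prop :=
  ContinuousOn α (Ici 0) ∧ StrictMonoOn α (Ici 0) ∧ α 0 = 0

/-- Class `𝒦_∞`: class `𝒦` and unbounded. -/
def IsClassKInf (α : ℝ → ℝ) : Prop :=
  IsClassK α ∧ Tendsto α atTop atTop

/-- Class `𝒦ℒ`. -/
def IsClassKL (β : ℝ → ℝ → ℝ) : Prop :=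
  ContinuousOn (fun p : ℝ × ℝ => β p.1 p.2) (Ici 0 ×ˢ Ici 0) ∧
    (∀ t, 0 ≤ t → IsClassK fun q => β q t) ∧
    ∀ q, 0 ≤ q → AntitoneOn (β q) (Ici 0) ∧ Tendsto (β q) atTop (𝓝 0)

/-- Class `𝒦ℒℒ`: `β(·, r, ·)` and `β(·, ·, r)` are of class `𝒦ℒ` for each `r ≥ 0`. -/
def IsClassKLL (β : ℝ → ℝ → ℝ → ℝ) : Prop :=
  ∀ r, 0 ≤ r → IsClassKL (fun q s => β q r s) ∧ IsClassKL (fun q s => β q s r)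

/-! ## Hybrid systems -/

/-- A compact hybrid time domain `⋃_{j < J} [t_j, t_{j+1}] × {j}`, `0 = t_0 ≤ t_1 ≤ ⋯ ≤ t_J`. -/
def IsCompactHybridTimeDomain (D : Set (ℝ × ℕ)) : Prop :=
  ∃ (J : ℕ) (t : ℕ → ℝ), t 0 = 0 ∧ (∀ j < J, t j ≤ t (j + 1)) ∧
    D = ⋃ j ∈ Iio J, Icc (t j) (t (j + 1)) ×ˢ {j}

/-- A hybrid time domain: every truncation at one of its points is a compact one. -/
def IsHybridTimeDomain (D : Set (ℝ × ℕ)) : Prop :=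
  (∀ p ∈ D, 0 ≤ p.1) ∧
    ∀ (T : ℝ) (J : ℕ), (T, J) ∈ D → IsCompactHybridTimeDomain (D ∩ Icc 0 T ×ˢ Iic J)

/-- A hybrid system `ξ̇ = F(ξ, w)` on the flow set, `ξ⁺ = G(ξ)` on the jump set. -/
structure HybridSystem (Ξ 𝒰 : Type*) where
  /-- the flow map `F` -/
  flow : Ξ → 𝒰 → Ξ
  /-- the jump map `G` -/
  jump : Ξ → Ξ
  /-- the flow set -/
  flowSet : Set Ξ
  /-- the jump set -/
  jumpSet : Set Ξ

/-- `(D, ξ)` is a solution for the input `w`. The values of `ξ` outside of `D` are irrelevant. -/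
structure HybridSystem.IsSolution {Ξ 𝒰 : Type*} [NormedAddCommGroup Ξ] [NormedSpace ℝ Ξ]
    (H : HybridSystem Ξ 𝒰) (w : ℝ → 𝒰) (D : Set (ℝ × ℕ)) (ξ : ℝ → ℕ → Ξ) : Prop where
  timeDomain : IsHybridTimeDomain D
  absCont : ∀ (j : ℕ) (a b : ℝ), a ≤ b → (a, j) ∈ D → (b, j) ∈ D →
    AbsolutelyContinuousOnInterval (fun t => ξ t j) a b
  flows : ∀ j : ℕ, ∀ᵐ t : ℝ, (t, j) ∈ D → ξ t j ∈ H.flowSet ∧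
    HasDerivWithinAt (fun s => ξ s j) (H.flow (ξ t j) (w t)) {s | (s, j) ∈ D} t
  jumps : ∀ (t : ℝ) (j : ℕ), (t, j) ∈ D → (t, j + 1) ∈ D →
    ξ t j ∈ H.jumpSet ∧ ξ t (j + 1) = H.jump (ξ t j)

/-! ## The networked control system with dynamic self-triggered sampling -/

/-- `ℝⁿ` with the Euclidean norm. -/
abbrev Vec (n : ℕ) : Type := EuclideanSpace ℝ (Fin n)

/-- Stacked vectors `[x_pᵀ, x_cᵀ]ᵀ` with the Euclidean norm. -/
abbrev Stacked (np nk : ℕ) : Type := EuclideanSpace ℝ (Fin np ⊕ Fin nk)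

/-- The plant component of a stacked vector. -/
def plantPart {np nk : ℕ} (x : Stacked np nk) : Vec np :=
  WithLp.toLp 2 fun i => x (Sum.inl i)

/-- The controller component of a stacked vector. -/
def ctrlPart {np nk : ℕ} (x : Stacked np nk) : Vec nk :=
  WithLp.toLp 2 fun i => x (Sum.inr i)

/-- The closed-loop vector field `f(x, e, w)` of the plant `ẋ_p = f_p(x_p, û, w)` and the controller
`ẋ_c = f_c(x_c, x̂_p)`, `u = g_c(x_c, x_p)`, where `e = x̂ - x`. -/
def closedLoop {np nk nu nw : ℕ} (fp : Vec np → Vec nu → Vec nw → Vec np)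
    (fc : Vec nk → Vec np → Vec nk) (gc : Vec nk → Vec np → Vec nu)
    (x e : Stacked np nk) (w : Vec nw) : Stacked np nk :=
  WithLp.toLp 2 (Sum.elim
    (fp (plantPart x) (gc (ctrlPart x + ctrlPart e) (plantPart x + plantPart e)) w)
    (fc (ctrlPart x) (plantPart x + plantPart e)))

/-- The hybrid state `ξ = (x, e, η, τ, τ_max)`. -/
abbrev StcState (X N : Type*) : Type _ := X × X × N × ℝ × ℝ

namespace StcState

variable {X N : Type*}

/-- the combined state of plant and controller -/
abbrev x (ξ : StcState X N) : X := ξ.1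

/-- the sampling-induced error -/
abbrev e (ξ : StcState X N) : X := ξ.2.1

/-- the internal state of the sampling mechanism -/
abbrev η (ξ : StcState X N) : N := ξ.2.2.1

/-- the time elapsed since the last sampling instant -/
abbrev τ (ξ : StcState X N) : ℝ := ξ.2.2.2.1

/-- the current sampling interval -/
abbrev τmax (ξ : StcState X N) : ℝ := ξ.2.2.2.2

end StcState

/-- The hybrid system of the closed loop with update rule `S` and sampling intervals `Γ`. -/
def stcSystem {X N 𝒰 : Type*} [AddGroup X] [Zero N] (f : X → X → 𝒰 → X)
    (S : N → X → N) (Γ : X → N → ℝ) : HybridSystem (StcState X N) 𝒰 where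
  flow ξ w := (f ξ.x ξ.e w, -f ξ.x ξ.e w, 0, 1, 0)
  jump ξ := (ξ.x, 0, S ξ.η ξ.x, 0, Γ ξ.x ξ.η)
  flowSet := {ξ | ξ.τ ≤ ξ.τmax}
  jumpSet := {ξ | ξ.τ = ξ.τmax}

/-- `(D, ξ)` is a solution of `H` for a locally integrable disturbance `w` with `|w(t)| ≤ w̄` for all
`t ≥ 0`, and the sampling mechanism is executed at the initial time: `τ_max(0,0) = τ(0,0) ≥ 0`. -/
structure IsStcTrajectory {X N 𝒰 : Type*} [NormedAddCommGroup X] [NormedSpace ℝ X]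
    [NormedAddCommGroup N] [NormedSpace ℝ N] [NormedAddCommGroup 𝒰]
    (H : HybridSystem (StcState X N) 𝒰) (wbar : ℝ) (w : ℝ → 𝒰) (D : Set (ℝ × ℕ))
    (ξ : ℝ → ℕ → StcState X N) : Prop where
  locallyIntegrable : LocallyIntegrableOn w (Ici 0)
  bounded : ∀ t, 0 ≤ t → ‖w t‖ ≤ wbar
  solution : H.IsSolution w D ξ
  init_nonneg : 0 ≤ (ξ 0 0).τ
  init_eq : (ξ 0 0).τmax = (ξ 0 0).τ

/-- The set `{V(x) ≤ c_w}` is robustly asymptotically stable with region of attraction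
`{V(x) ≤ c_max}`, for disturbances bounded by `w̄`. -/
def IsRAS {X N 𝒰 : Type*} [NormedAddCommGroup X] [NormedSpace ℝ X]
    [NormedAddCommGroup N] [NormedSpace ℝ N] [NormedAddCommGroup 𝒰]
    (H : HybridSystem (StcState X N) 𝒰) (wbar : ℝ) (V : X → ℝ) (cw cmax : ℝ) : Prop :=
  ∃ β : ℝ → ℝ → ℝ → ℝ, IsClassKLL β ∧
    ∀ (w : ℝ → 𝒰) (D : Set (ℝ × ℕ)) (ξ : ℝ → ℕ → StcState X N),
      IsStcTrajectory H wbar w D ξ → V (ξ 0 0).x ≤ cmax →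
      ∀ (t : ℝ) (j : ℕ), (t, j) ∈ D →
        V (ξ t j).x ≤ cw +
          β (max (V (ξ 0 0).x - cw) 0 + √(‖(ξ 0 0).e‖ ^ 2 + ‖(ξ 0 0).η‖ ^ 2)) t j

/-! ## The local Lyapunov-type condition -/

/-- The local hybrid Lyapunov condition on the sublevel set `{V ≤ c}`, for disturbances bounded by
`w̄`, with parameters `ε, γ, L` and the given functions `V` and `α_w`. Here `e = x̂ - x`, so
`x̂ = x + e`, and `g = -f`. The functions `W` and `V` are differentiable almost everywhere. -/
def LocalHybridLyapunov {X 𝒰 : Type*} [NormedAddCommGroup X] [InnerProductSpace ℝ X]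
    [CompleteSpace X] [MeasureSpace X] [NormedAddCommGroup 𝒰]
    (f : X → X → 𝒰 → X) (wbar : ℝ) (V : X → ℝ) (αw : ℝ → ℝ) (c ε γ L : ℝ) : Prop :=
  0 < L ∧ 0 < γ ∧ LocallyLipschitz V ∧ IsClassKInf αw ∧
  ∃ (W : X → ℝ) (H : X → X → 𝒰 → ℝ) (αWl αWu αVl αVu : ℝ → ℝ),
    LocallyLipschitz W ∧
    ContinuousOn (fun p : X × X × 𝒰 => H p.1 p.2.1 p.2.2) {p | ‖p.2.2‖ ≤ wbar} ∧
    (∀ x e w, ‖w‖ ≤ wbar → 0 ≤ H x e w) ∧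
    IsClassKInf αWl ∧ IsClassKInf αWu ∧ IsClassKInf αVl ∧ IsClassKInf αVu ∧
    (∀ e, αWl ‖e‖ ≤ W e ∧ W e ≤ αWu ‖e‖) ∧
    (∀ x, αVl ‖x‖ ≤ V x ∧ V x ≤ αVu ‖x‖) ∧
    (∀ x w, V x ≤ c → ‖w‖ ≤ wbar → ∀ᵐ e, V (x + e) ≤ c →
      inner ℝ (gradient W e) (-f x e w) ≤ L * W e + H x e w) ∧
    (∀ e w, ‖w‖ ≤ wbar → ∀ᵐ x, V x ≤ c → V (x + e) ≤ c →
      inner ℝ (gradient V x) (f x e w) ≤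
        -ε * V x - H x e w ^ 2 + γ ^ 2 * W e ^ 2 + αw ‖w‖)

/-! ## The sampling mechanism -/

/-- The function `T_max(γ, Λ)`. -/
noncomputable def Tmax (γ Λ : ℝ) : ℝ :=
  let r := √|(γ / Λ) ^ 2 - 1|
  if Λ < γ then 1 / (Λ * r) * Real.arctan r
  else if γ = Λ then 1 / Λ
  else 1 / (Λ * r) * Real.artanh r

/-- The candidate interval `h̄_i` for the parameters `ε, γ, L`, where `v`, `C` are the current values
of `V(x)`, `C(x, η)`, and `a = α_w(w̄)`. -/
noncomputable def candidateInterval (δ εref a v C ε γ L : ℝ) : ℝ :=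
  if v ≤ C then
    if 0 < -ε + εref then
      min (δ * Tmax γ (max (L + ε / 2) (1 - δ)))
        ((Real.log (C - a / ε) - Real.log (v - a / ε)) / (-ε + εref))
    else δ * Tmax γ (max (L + ε / 2) (1 - δ))
  else 0

/-- The fall-back interval for the parameters `ε, γ, L`. -/
noncomputable def fallbackInterval (δ ε γ L : ℝ) : ℝ := δ * Tmax γ (L + ε / 2)

/-- The loop of the algorithm over the parameter sets. The first parameter set has the index `0`;
`h̄` starts at its fall-back interval and is updated by larger candidates of the other ones. -/
noncomputable def intervalLoop {npar : ℕ} [NeZero npar] (δ εref a v C : ℝ)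
    (ε γ L : Fin npar → ℝ) : ℝ :=
  ((List.finRange npar).filter (fun i => i ≠ 0)).foldl
    (fun h i =>
      if h < candidateInterval δ εref a v C (ε i) (γ i) (L i) then
        candidateInterval δ εref a v C (ε i) (γ i) (L i)
      else h)
    (fallbackInterval δ (ε 0) (γ 0) (L 0))

/-- `Γ(x, η)` is the output of the algorithm wherever the algorithm can be executed, that is,
wherever some `l` satisfies `c_l ≥ max {V(x), C(x, η)}`; the smallest such `l` is used. -/
def IsComputedByAlgorithm {X N : Type*} {npar nc : ℕ} [NeZero npar] (δ εref a : ℝ)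
    (V : X → ℝ) (C : X → N → ℝ) (c : Fin nc → ℝ) (ε γ L : Fin npar → Fin nc → ℝ)
    (Γ : X → N → ℝ) : Prop :=
  ∀ (x : X) (η : N) (l : Fin nc), IsLeast {l | max (V x) (C x η) ≤ c l} l →
    Γ x η = intervalLoop δ εref a (V x) (C x η)
      (fun i => ε i l) (fun i => γ i l) (fun i => L i l)

/-- The clipped filter state `C(x, η) = max {min {η, c_max}, c_w}`. -/
noncomputable def clippedIIR {X : Type*} (cw cmax : ℝ) (_x : X) (η : ℝ) : ℝ :=
  max (min η cmax) cw

/-- The update rule `S(η, x) = e^{-ε_ref Γ(x, η)} (r₁ η + r₂ V(x))`. -/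
noncomputable def iirUpdate {X : Type*} (εref r₁ r₂ : ℝ) (V : X → ℝ) (Γ : X → ℝ → ℝ)
    (η : ℝ) (x : X) : ℝ :=
  Real.exp (-εref * Γ x η) * (r₁ * η + r₂ * V x)

set_option linter.unusedSectionVars false

/-! ## Absolutely continuous functions -/

/-! Between two samples, consider U = V + γ φ W², where φ > 0 solves φ' = -2Λφ - γ(φ² + 1) with Λ ≥
L + ε/2. Adding the two inequalities of the local condition and completing a square gives U' ≤ -ε U
+ α_w(w̄) (`storage_deriv_le`). Such a φ exists on every interval shorter than `Tmax γ Λ`, the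
blow-up time of the time-reversed equation started at 0 (`exists_riccati`). A jump resets e to 0, so
U starts at V(x̂), and V ≤ U throughout.

For the fall-back parameters (ε > 0), U relaxes to α_w(w̄)/ε ≤ c_w, so the excess of V over c_w
contracts. For the other parameters (ε < 0), U may grow, but the logarithmic term in the candidate
interval is the time for which the growing bound stays below e^{-ε_ref t} C. In both cases, and by
the choice of S also for η, the quantity max {max {V, η} - c_w, 0} contracts with one common rate μ
(`isDecayingSampling`, `IsDecayingSampling.decay_after_jump`). The interval before the first jump is
a single point and every later complete interval lasts at least t_min; hence elapsed time controls
the number of jumps, and the exponential in t can be shared between t and j.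

The delicate point is that the inequalities hold only almost everywhere, while a trajectory may run
inside the exceptional null set. It is therefore translated: by Fubini, for almost all p the curve
(x + p₁, e + p₂) meets the exceptional set only at a null set of times. Its velocity is still f at
the original point, which by continuity costs an arbitrarily small error κ
(`LyapunovPair.eventually_storage_deriv_le`). Then p and κ tend to 0
(`LyapunovPair.storage_le_of_translates`).

Translates are usable only if x̂ + p₁ + p₂ lies in {V ≤ c}, so x̂ has to be in the closure of {V <
c}. This is why starting points with V(x̂) = c need separate arguments: either the closure
hypothesis at the top level, or the condition on a larger sublevel set. -/

theorem LipschitzOnWith.comp_absolutelyContinuousOnInterval {E F : Type*} [PseudoMetricSpace E]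
    [PseudoMetricSpace F] {g : E → F} {f : ℝ → E} {K : NNReal} {s : Set E} {a b : ℝ}
    (hg : LipschitzOnWith K g s) (hf : AbsolutelyContinuousOnInterval f a b)
    (hs : MapsTo f (uIcc a b) s) : AbsolutelyContinuousOnInterval (fun t => g (f t)) a b := by
  rw [absolutelyContinuousOnInterval_iff] at hf ⊢
  intro ε hε
  obtain ⟨δ, hδ, h⟩ := hf (ε / (K + 1)) (by positivity)
  refine ⟨δ, hδ, fun E hE hE' => ?_⟩
  have h1 := h E hE hE'
  rw [lt_div_iff₀ (by positivity)] at h1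
  have h2 : ∑ i ∈ Finset.range E.1, dist (g (f (E.2 i).1)) (g (f (E.2 i).2)) ≤
      K * ∑ i ∈ Finset.range E.1, dist (f (E.2 i).1) (f (E.2 i).2) := by
    rw [Finset.mul_sum]
    exact Finset.sum_le_sum fun i hi =>
      hg.dist_le_mul _ (hs (hE.1 i hi).1) _ (hs (hE.1 i hi).2)
  have h3 : 0 ≤ ∑ i ∈ Finset.range E.1, dist (f (E.2 i).1) (f (E.2 i).2) :=
    Finset.sum_nonneg fun _ _ => dist_nonneg
  nlinarith

theorem LocallyLipschitz.exists_lipschitzOnWith_of_isCompact {E F : Type*} [PseudoMetricSpace E]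
    [PseudoMetricSpace F] {g : E → F} (hg : LocallyLipschitz g) {s : Set E} (hs : IsCompact s) :
    ∃ K, LipschitzOnWith K g s :=
  LocallyLipschitzOn.exists_lipschitzOnWith_of_compact hs (hg.locallyLipschitzOn)

theorem LocallyLipschitz.comp_absolutelyContinuousOnInterval {E F : Type*} [PseudoMetricSpace E]
    [PseudoMetricSpace F] {g : E → F} {f : ℝ → E} {a b : ℝ}
    (hg : LocallyLipschitz g) (hf : AbsolutelyContinuousOnInterval f a b)
    (hc : ContinuousOn f (uIcc a b)) : AbsolutelyContinuousOnInterval (fun t => g (f t)) a b := by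
  obtain ⟨K, hK⟩ := hg.exists_lipschitzOnWith_of_isCompact (isCompact_uIcc.image_of_continuousOn hc)
  exact hK.comp_absolutelyContinuousOnInterval hf (mapsTo_image _ _)

theorem AbsolutelyContinuousOnInterval.le_of_ae_deriv_nonpos {g : ℝ → ℝ} {a b : ℝ} (hab : a ≤ b)
    (hg : AbsolutelyContinuousOnInterval g a b)
    (h : ∀ᵐ t, t ∈ Ioo a b → ∃ d ≤ 0, HasDerivAt g d t) : g b ≤ g a := by
  have h1 := hg.integral_deriv_eq_sub
  have h2 : ∫ x in a..b, deriv g x ≤ 0 := by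
    rw [intervalIntegral.integral_of_le hab]
    refine integral_nonpos_of_ae ?_
    rw [Filter.EventuallyLE, ← restrict_Ioo_eq_restrict_Ioc, ae_restrict_iff' measurableSet_Ioo]
    filter_upwards [h] with t ht hm
    obtain ⟨d, hd, hd'⟩ := ht hm
    simpa [hd'.deriv] using hd
  linarith

/-- The solution of `u' = -ε u + β` at time `s` that starts at `u`. -/
noncomputable def expBound (ε β u s : ℝ) : ℝ := β / ε + Real.exp (-ε * s) * (u - β / ε)

/-- Integrating factor: e^{ε(t-a)} (U - β/ε) is absolutely continuous with nonpositive derivative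
almost everywhere. Both signs of ε are needed later. -/
theorem AbsolutelyContinuousOnInterval.le_expBound {U : ℝ → ℝ} {a b ε β : ℝ} (hab : a ≤ b)
    (hε : ε ≠ 0) (hU : AbsolutelyContinuousOnInterval U a b)
    (h : ∀ᵐ t, t ∈ Ioo a b → ∃ d, HasDerivAt U d t ∧ d ≤ -ε * U t + β) :
    U b ≤ expBound ε β (U a) (b - a) := by
  have he : AbsolutelyContinuousOnInterval (fun t => Real.exp (ε * (t - a))) a b := by
    apply ContDiffOn.absolutelyContinuousOnInterval
    fun_prop
  have hc : AbsolutelyContinuousOnInterval (fun _ : ℝ => β / ε) a b :=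
    contDiffOn_const.absolutelyContinuousOnInterval
  have hg := he.fun_mul (hU.fun_sub hc)
  have := hg.le_of_ae_deriv_nonpos hab (by
    filter_upwards [h] with t ht hm
    obtain ⟨d, hd, hd'⟩ := ht hm
    have h1 : HasDerivAt (fun t => Real.exp (ε * (t - a))) (Real.exp (ε * (t - a)) * ε) t := by
      have := (((hasDerivAt_id t).sub_const a).const_mul ε).exp
      simpa using this
    refine ⟨_, ?_, h1.mul (hd.sub_const (β / ε))⟩
    have h2 : ε * (U t - β / ε) = ε * U t - β := by field_simp
    have h3 : Real.exp (ε * (t - a)) * ε * (U t - β / ε) + Real.exp (ε * (t - a)) * d =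
      Real.exp (ε * (t - a)) * (ε * U t - β + d) := by rw [← h2]; ring
    rw [h3]
    exact mul_nonpos_of_nonneg_of_nonpos (Real.exp_pos _).le (by linarith))
  simp only [sub_self, mul_zero, Real.exp_zero, one_mul] at this
  rw [expBound]
  have h4 : Real.exp (-ε * (b - a)) * Real.exp (ε * (b - a)) = 1 := by
    rw [← Real.exp_add]; simp
  have h5 := mul_le_mul_of_nonneg_left this (Real.exp_pos (-ε * (b - a))).le
  rw [← mul_assoc, h4] at h5
  linarith

/-- A differential inequality that holds where `v < c` bounds `U` as long as the bound on `U`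
keeps `v` below `c`. -/
theorem AbsolutelyContinuousOnInterval.le_expBound_of_barrier {U v : ℝ → ℝ} {a b c ε β : ℝ}
    (hε : ε ≠ 0) (hU : AbsolutelyContinuousOnInterval U a b) (hv : ContinuousOn v (Icc a b))
    (h : ∀ᵐ t, t ∈ Ioo a b → v t < c → ∃ d, HasDerivAt U d t ∧ d ≤ -ε * U t + β)
    (hb : ∀ t ∈ Icc a b, U t ≤ expBound ε β (U a) (t - a) → v t < c) :
    ∀ t ∈ Icc a b, U t ≤ expBound ε β (U a) (t - a) := by
  have key : ∀ T ∈ Icc a b, (∀ t ∈ Ico a T, v t < c) → U T ≤ expBound ε β (U a) (T - a) := by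
    intro T hT hlt
    have hab : a ≤ b := hT.1.trans hT.2
    refine (hU.mono ?_).le_expBound hT.1 hε ?_
    · rw [uIcc_of_le hT.1, uIcc_of_le hab]; exact Icc_subset_Icc_right hT.2
    · filter_upwards [h] with t ht hm
      exact ht ⟨hm.1, hm.2.trans_le hT.2⟩ (hlt t ⟨hm.1.le, hm.2⟩)
  by_cases hS : ∃ t ∈ Icc a b, c ≤ v t
  · exfalso
    have hcl : IsCompact (Icc a b ∩ v ⁻¹' Ici c) :=
      isCompact_Icc.of_isClosed_subset (hv.preimage_isClosed_of_isClosed isClosed_Icc isClosed_Ici)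
        inter_subset_left
    -- `T` is the first time at which v reaches c. Before `T` the differential inequality holds, so
    -- U obeys the bound at `T` itself, and `hb` then gives v T < c.
    obtain ⟨T, hT⟩ := hcl.exists_isLeast (by obtain ⟨t, ht, ht'⟩ := hS; exact ⟨t, ht, ht'⟩)
    have h1 := key T hT.1.1 (fun t ht => by
      by_contra hcon
      exact absurd (hT.2 ⟨⟨ht.1, ht.2.le.trans hT.1.1.2⟩, not_lt.1 hcon⟩) (not_le.2 ht.2))
    exact absurd (hb T hT.1.1 h1) (not_lt.2 hT.1.2)
  · push Not at hS
    exact fun T hT => key T hT fun t ht => hS t ⟨ht.1, ht.2.le.trans hT.2⟩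

theorem expBound_zero (ε β u : ℝ) : expBound ε β u 0 = u := by simp [expBound]

/-- For `ε > 0` the bound is a convex combination of the initial value and the limit. -/
theorem expBound_le_max {ε β u s : ℝ} (hε : 0 < ε) (hs : 0 ≤ s) :
    expBound ε β u s ≤ max u (β / ε) := by
  have h1 : Real.exp (-ε * s) ≤ 1 := Real.exp_le_one_iff.2 (by nlinarith)
  have h2 := (Real.exp_pos (-ε * s)).le
  rw [expBound]
  nlinarith [le_max_left u (β / ε), le_max_right u (β / ε)]

/-- Strictness comes from the limit β/ε, whose weight 1 - e^{-εs} is positive once s > 0. -/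
theorem expBound_lt {ε β u s c : ℝ} (hε : 0 < ε) (hs : 0 < s) (hu : u ≤ c) (hβ : β / ε < c) :
    expBound ε β u s < c := by
  have h1 : Real.exp (-ε * s) < 1 := Real.exp_lt_one_iff.2 (by nlinarith)
  have h2 := (Real.exp_pos (-ε * s)).le
  rw [expBound]
  nlinarith

/-- Strictness comes from the initial value, whose weight e^{-εs} is always positive. -/
theorem expBound_lt' {ε β u s c : ℝ} (hε : 0 < ε) (hs : 0 ≤ s) (hu : u < c) (hβ : β / ε ≤ c) :
    expBound ε β u s < c := by
  have h1 : Real.exp (-ε * s) ≤ 1 := Real.exp_le_one_iff.2 (by nlinarith)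
  have h2 := (Real.exp_pos (-ε * s))
  rw [expBound]
  nlinarith

/-! ## The Riccati equation behind `Tmax` -/

/-- If `S' = C`, `C' = (Λ² - γ²) S`, then `γ S / (C - Λ S)` solves `ψ' = γ (ψ² + 1) + 2 Λ ψ`. -/
theorem hasDerivAt_riccati {S C : ℝ → ℝ} {γ Λ s : ℝ}
    (hS : HasDerivAt S (C s) s) (hC : HasDerivAt C ((Λ ^ 2 - γ ^ 2) * S s) s)
    (hne : C s - Λ * S s ≠ 0) :
    HasDerivAt (fun s => γ * S s / (C s - Λ * S s))
      (γ * ((γ * S s / (C s - Λ * S s)) ^ 2 + 1) + 2 * Λ * (γ * S s / (C s - Λ * S s))) s := by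
  have := (hS.const_mul γ).div (hC.sub (hS.const_mul Λ)) hne
  refine this.congr_deriv ?_
  simp only [Pi.sub_apply]
  field_simp
  ring

/-- Time is reversed from some T' > T: for t in [0, T] the argument T' - t stays in (0, T'], away
from the zero of the quotient at 0 and from its pole. -/
theorem exists_riccati_of_solution {S C : ℝ → ℝ} {γ Λ T T' : ℝ} (hγ : 0 < γ) (hT : T < T')
    (hS : ∀ s, HasDerivAt S (C s) s) (hC : ∀ s, HasDerivAt C ((Λ ^ 2 - γ ^ 2) * S s) s)
    (hpos : ∀ s, 0 < s → s ≤ T' → 0 < S s ∧ 0 < C s - Λ * S s) :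
    ∃ φ : ℝ → ℝ, ∀ t ∈ Icc 0 T,
      0 < φ t ∧ HasDerivAt φ (-2 * Λ * φ t - γ * (φ t ^ 2 + 1)) t := by
  refine ⟨fun t => γ * S (T' - t) / (C (T' - t) - Λ * S (T' - t)), fun t ht => ?_⟩
  obtain ⟨hp, hp'⟩ := hpos (T' - t) (by linarith [ht.2]) (by linarith [ht.1])
  refine ⟨by positivity, ?_⟩
  have hd := hasDerivAt_riccati (γ := γ) (hS _) (hC _) hp'.ne'
  have := hd.comp t ((hasDerivAt_id t).const_sub T')
  refine this.congr_deriv ?_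
  ring

theorem Tmax_pos {γ Λ : ℝ} (hγ : 0 < γ) (hΛ : 0 < Λ) : 0 < Tmax γ Λ := by
  have hq : 0 < γ / Λ := by positivity
  simp only [Tmax]
  split_ifs with h1 h2
  · have : 1 < γ / Λ := by rwa [one_lt_div hΛ]
    have h3 : 0 < √|(γ / Λ) ^ 2 - 1| :=
      Real.sqrt_pos.2 (abs_pos.2 (by nlinarith))
    have := Real.arctan_pos.2 h3
    positivity
  · positivity
  · have h4 : γ / Λ < 1 := by
      rw [div_lt_one hΛ]; exact lt_of_le_of_ne (not_lt.1 h1) h2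
    have h5 : |(γ / Λ) ^ 2 - 1| = 1 - (γ / Λ) ^ 2 := by
      rw [abs_of_nonpos (by nlinarith)]; ring
    rw [h5]
    have h3 : 0 < √(1 - (γ / Λ) ^ 2) := Real.sqrt_pos.2 (by nlinarith)
    have h6 : √(1 - (γ / Λ) ^ 2) < 1 := by
      rw [Real.sqrt_lt' one_pos]; nlinarith
    have := Real.artanh_pos ⟨h3, h6⟩
    positivity

/-- S is the solution of S'' = (Λ² - γ²) S with S(0) = 0, S'(0) = 1: a sine, the identity or a
hyperbolic sine, according to the sign. The pole of the quotient is the first positive zero of S' -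
ΛS, that is tan(κs) = κ/Λ, s = 1/Λ or tanh(κs) = κ/Λ with κ = √|γ² - Λ²|. Since κ = Λr, this zero is
`Tmax γ Λ`. -/
theorem exists_riccati {γ Λ T : ℝ} (hγ : 0 < γ) (hΛ : 0 < Λ) (hT : T < Tmax γ Λ) :
    ∃ φ : ℝ → ℝ, ∀ t ∈ Icc 0 T,
      0 < φ t ∧ HasDerivAt φ (-2 * Λ * φ t - γ * (φ t ^ 2 + 1)) t := by
  obtain ⟨T', hTT', hT'⟩ := exists_between hT
  simp only [Tmax] at hT'
  split_ifs at hT' with hlt heq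
  · set κ := √(γ ^ 2 - Λ ^ 2) with hκ
    have hκ2 : κ ^ 2 = γ ^ 2 - Λ ^ 2 := Real.sq_sqrt (by nlinarith)
    have hκ0 : 0 < κ := Real.sqrt_pos.2 (by nlinarith)
    have hr : √|(γ / Λ) ^ 2 - 1| = κ / Λ := by
      rw [show (γ / Λ) ^ 2 - 1 = (γ ^ 2 - Λ ^ 2) / Λ ^ 2 by field_simp,
        abs_of_nonneg (div_nonneg (by nlinarith) (by positivity)),
        Real.sqrt_div (by nlinarith), Real.sqrt_sq hΛ.le]
    rw [hr, mul_div_cancel₀ _ hΛ.ne', one_div_mul_eq_div, lt_div_iff₀ hκ0] at hT'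
    refine exists_riccati_of_solution (S := fun s => Real.sin (κ * s) / κ)
      (C := fun s => Real.cos (κ * s)) hγ hTT' (fun s => ?_) (fun s => ?_) ?_
    · have := (((hasDerivAt_id s).const_mul κ).sin).div_const κ
      refine this.congr_deriv ?_
      simp [hκ0.ne']
    · have := (((hasDerivAt_id s).const_mul κ).cos)
      refine this.congr_deriv ?_
      rw [show Λ ^ 2 - γ ^ 2 = -κ ^ 2 by linarith]
      simp only [id]; field_simp
    · intro s hs hsT
      have h1 : κ * s < Real.arctan (κ / Λ) := by nlinarith
      have h2 : κ * s < Real.pi / 2 := h1.trans (Real.arctan_lt_pi_div_two _)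
      have h0 : 0 < κ * s := by positivity
      have hs0 : 0 < Real.sin (κ * s) := Real.sin_pos_of_pos_of_lt_pi h0 (by linarith [Real.pi_pos])
      have hc0 : 0 < Real.cos (κ * s) := Real.cos_pos_of_mem_Ioo ⟨by linarith, h2⟩
      refine ⟨by positivity, ?_⟩
      have h3 : Real.tan (κ * s) < κ / Λ := by
        rw [← Real.tan_arctan (κ / Λ)]
        exact Real.tan_lt_tan_of_lt_of_lt_pi_div_two (by linarith)
          (Real.arctan_lt_pi_div_two _) h1
      rw [Real.tan_eq_sin_div_cos, div_lt_div_iff₀ hc0 hΛ] at h3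
      have : Λ * (Real.sin (κ * s) / κ) < Real.cos (κ * s) := by
        rw [← mul_div_assoc, div_lt_iff₀ hκ0]; linarith
      linarith
  · subst heq
    refine exists_riccati_of_solution (S := fun s => s) (C := fun _ => 1) hγ hTT'
      (fun s => hasDerivAt_id s) (fun s => ?_) ?_
    · simpa using hasDerivAt_const s (1 : ℝ)
    · intro s hs hsT
      refine ⟨hs, ?_⟩
      rw [lt_div_iff₀ hΛ] at hT'
      nlinarith
  · have hlt' : γ < Λ := lt_of_le_of_ne (not_lt.1 hlt) heq
    set κ := √(Λ ^ 2 - γ ^ 2) with hκ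
    have hκ2 : κ ^ 2 = Λ ^ 2 - γ ^ 2 := Real.sq_sqrt (by nlinarith)
    have hκ0 : 0 < κ := Real.sqrt_pos.2 (by nlinarith)
    have hr : √|(γ / Λ) ^ 2 - 1| = κ / Λ := by
      rw [show (γ / Λ) ^ 2 - 1 = -((Λ ^ 2 - γ ^ 2) / Λ ^ 2) by field_simp; ring, abs_neg,
        abs_of_nonneg (div_nonneg (by nlinarith) (by positivity)),
        Real.sqrt_div (by nlinarith), Real.sqrt_sq hΛ.le]
    rw [hr, mul_div_cancel₀ _ hΛ.ne', one_div_mul_eq_div, lt_div_iff₀ hκ0] at hT'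
    have hκΛ : κ / Λ ∈ Ioo (-1) 1 := by
      refine ⟨by have : 0 < κ / Λ := by positivity
                 linarith, ?_⟩
      rw [div_lt_one hΛ]; nlinarith
    refine exists_riccati_of_solution (S := fun s => Real.sinh (κ * s) / κ)
      (C := fun s => Real.cosh (κ * s)) hγ hTT' (fun s => ?_) (fun s => ?_) ?_
    · have := (((hasDerivAt_id s).const_mul κ).sinh).div_const κ
      refine this.congr_deriv ?_
      simp [hκ0.ne']
    · have := (((hasDerivAt_id s).const_mul κ).cosh)
      refine this.congr_deriv ?_
      rw [← hκ2]
      simp only [id]; field_simp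
    · intro s hs hsT
      have h1 : κ * s < Real.artanh (κ / Λ) := by nlinarith
      have h0 : 0 < κ * s := by positivity
      have hs0 : 0 < Real.sinh (κ * s) := Real.sinh_pos_iff.2 h0
      have hc0 : 0 < Real.cosh (κ * s) := Real.cosh_pos _
      refine ⟨by positivity, ?_⟩
      have h3 : Real.tanh (κ * s) < κ / Λ := by
        have hm : Real.tanh (κ * s) ∈ Ioo (-1) 1 := Real.tanh_bijOn.mapsTo (mem_univ _)
        rw [← Real.artanh_lt_artanh_iff hm hκΛ, Real.artanh_tanh]
        exact h1
      rw [Real.tanh_eq_sinh_div_cosh, div_lt_div_iff₀ hc0 hΛ] at h3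
      have : Λ * (Real.sinh (κ * s) / κ) < Real.cosh (κ * s) := by
        rw [← mul_div_assoc, div_lt_iff₀ hκ0]; linarith
      linarith

/-! ## Flow segments and their translates -/

/-- The data of the local Lyapunov condition in the form used along solutions; `A` bounds
`α_w(|w|)`. -/
structure LyapunovPair {X 𝒰 : Type*} [NormedAddCommGroup X] [InnerProductSpace ℝ X]
    [CompleteSpace X] [MeasureSpace X] [NormedAddCommGroup 𝒰]
    (f : X → X → 𝒰 → X) (wbar : ℝ) (V : X → ℝ) (A c ε γ L : ℝ) (W : X → ℝ)
    (H : X → X → 𝒰 → ℝ) : Prop where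
  pos_γ : 0 < γ
  lip_V : LocallyLipschitz V
  lip_W : LocallyLipschitz W
  cont_H : ContinuousOn (fun p : X × X × 𝒰 => H p.1 p.2.1 p.2.2) {p | ‖p.2.2‖ ≤ wbar}
  W_zero : W 0 = 0
  W_pos : ∀ e, e ≠ 0 → 0 < W e
  flow_W : ∀ x w, V x ≤ c → ‖w‖ ≤ wbar → ∀ᵐ e, V (x + e) ≤ c →
    inner ℝ (gradient W e) (-f x e w) ≤ L * W e + H x e w
  flow_V : ∀ e w, ‖w‖ ≤ wbar → ∀ᵐ x, V x ≤ c → V (x + e) ≤ c →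
    inner ℝ (gradient V x) (f x e w) ≤ -ε * V x - H x e w ^ 2 + γ ^ 2 * W e ^ 2 + A

/-- The pair `(x, e)` follows `ẋ = f(x, e, w)`, `ė = -f(x, e, w)` on `[a, b]`, with `x + e = x̂`. -/
structure IsFlowSegment {X 𝒰 : Type*} [NormedAddCommGroup X] [NormedSpace ℝ X]
    [NormedAddCommGroup 𝒰] (f : X → X → 𝒰 → X) (wbar : ℝ) (w : ℝ → 𝒰) (x e : ℝ → X) (xhat : X)
    (a b : ℝ) : Prop where
  le : a ≤ b
  ac_x : AbsolutelyContinuousOnInterval x a b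
  ac_e : AbsolutelyContinuousOnInterval e a b
  add_eq : ∀ t ∈ Icc a b, x t + e t = xhat
  deriv : ∀ᵐ t, t ∈ Ioo a b →
    HasDerivAt x (f (x t) (e t) (w t)) t ∧ HasDerivAt e (-f (x t) (e t) (w t)) t
  meas : AEStronglyMeasurable w (volume.restrict (Icc a b))
  bound : ∀ t ∈ Icc a b, ‖w t‖ ≤ wbar

/-- A positive solution of the Riccati equation on `[a, b]`. -/
def IsRiccati (φ : ℝ → ℝ) (γ Λ a b : ℝ) : Prop :=
  ∀ t ∈ Icc a b, 0 < φ t ∧ HasDerivAt φ (-2 * Λ * φ t - γ * (φ t ^ 2 + 1)) t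

/-- The function `V(x) + γ φ(t) W(e)²`. -/
def storage {X : Type*} (V W : X → ℝ) (γ : ℝ) (φ : ℝ → ℝ) (t : ℝ) (x e : X) : ℝ :=
  V x + γ * φ t * W e ^ 2

theorem IsRiccati.mono {φ : ℝ → ℝ} {γ Λ a b a' b' : ℝ} (h : IsRiccati φ γ Λ a b) (ha : a ≤ a')
    (hb : b' ≤ b) : IsRiccati φ γ Λ a' b' :=
  fun t ht => h t ⟨ha.trans ht.1, ht.2.trans hb⟩

theorem IsRiccati.shift {φ : ℝ → ℝ} {γ Λ T : ℝ} (h : IsRiccati φ γ Λ 0 T) (s : ℝ) :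
    IsRiccati (fun t => φ (t - s)) γ Λ s (s + T) := by
  intro t ht
  obtain ⟨h1, h2⟩ := h (t - s) ⟨by linarith [ht.1], by linarith [ht.2]⟩
  exact ⟨h1, by simpa using h2.comp_sub_const t s⟩

theorem IsRiccati.continuousOn {φ : ℝ → ℝ} {γ Λ a b : ℝ} (h : IsRiccati φ γ Λ a b) :
    ContinuousOn φ (Icc a b) :=
  fun t ht => (h t ht).2.continuousAt.continuousWithinAt

/-- φ is bounded on the compact interval, so the equation bounds its derivative and φ is Lipschitz.
-/
theorem IsRiccati.absolutelyContinuous {φ : ℝ → ℝ} {γ Λ a b : ℝ} (h : IsRiccati φ γ Λ a b)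
    (hab : a ≤ b) : AbsolutelyContinuousOnInterval φ a b := by
  have hc : ContinuousOn (fun t => -2 * Λ * φ t - γ * (φ t ^ 2 + 1)) (Icc a b) := by
    have := h.continuousOn
    fun_prop
  obtain ⟨K, hK⟩ := isCompact_Icc.exists_bound_of_continuousOn hc
  have : LipschitzOnWith (Real.toNNReal K) φ (Icc a b) :=
    (convex_Icc a b).lipschitzOnWith_of_nnnorm_hasDerivWithin_le
      (fun t ht => (h t ht).2.hasDerivWithinAt) fun t ht => by
        rw [← NNReal.coe_le_coe, coe_nnnorm]
        exact (hK t ht).trans (Real.le_coe_toNNReal K)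
  rw [← uIcc_of_le hab] at this
  exact this.absolutelyContinuousOnInterval

theorem le_storage {X : Type*} {V W : X → ℝ} {γ : ℝ} {φ : ℝ → ℝ} {t : ℝ} (hγ : 0 ≤ γ)
    (hφ : 0 ≤ φ t) (x e : X) : V x ≤ storage V W γ φ t x e := by
  have : 0 ≤ γ * φ t * W e ^ 2 := by positivity
  simp only [storage]; linarith

/-! ### Almost all translates avoid the exceptional null sets. -/

section

variable {X 𝒰 : Type*} [NormedAddCommGroup X] [InnerProductSpace ℝ X] [FiniteDimensional ℝ X]
  [MeasureSpace X] [BorelSpace X] [(volume : Measure X).IsAddHaarMeasure]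
  [NormedAddCommGroup 𝒰] [ProperSpace 𝒰] [MeasurableSpace 𝒰] [BorelSpace 𝒰]

/-- Rademacher's theorem on balls that exhaust the space. -/
theorem LocallyLipschitz.ae_differentiableAt {g : X → ℝ} (hg : LocallyLipschitz g) :
    ∀ᵐ x, DifferentiableAt ℝ g x := by
  have : ∀ n : ℕ, ∀ᵐ x, x ∈ Metric.ball (0 : X) n → DifferentiableAt ℝ g x := by
    intro n
    obtain ⟨K, hK⟩ := hg.exists_lipschitzOnWith_of_isCompact (isCompact_closedBall (0 : X) n)
    have h1 := (hK.mono Metric.ball_subset_closedBall).ae_differentiableWithinAt_of_mem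
      (μ := (volume : Measure X))
    filter_upwards [h1] with x hx hm
    exact (hx hm).differentiableAt (Metric.isOpen_ball.mem_nhds hm)
  filter_upwards [ae_all_iff.2 this] with x hx
  obtain ⟨n, hn⟩ := exists_nat_gt ‖x‖
  exact hx n (by simpa using hn)

theorem measurable_gradient (g : X → ℝ) : Measurable (gradient g) :=
  ((InnerProductSpace.toDual ℝ X).symm.continuous.measurable).comp (measurable_fderiv ℝ g)

theorem inner_gradient_eq_fderiv (g : X → ℝ) (x v : X) :
    inner ℝ (gradient g x) v = fderiv ℝ g x v := by
  simp [gradient]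

theorem ae_add_left {P : X → Prop} (h : ∀ᵐ x, P x) (u : X) : ∀ᵐ x, P (u + x) :=
  (measurePreserving_add_left volume u).quasiMeasurePreserving.ae h

/-- For each fixed time only a null set of translations is bad; Fubini exchanges "every t, almost
every p" for "almost every p, almost every t". -/
theorem ae_translate {S : Set (X × X × 𝒰)} (hS : MeasurableSet S) {x e : ℝ → X} {w : ℝ → 𝒰}
    (hx : Measurable x) (he : Measurable e) (hw : Measurable w)
    (h : ∀ u v r, ∀ᵐ p : X × X, (u + p.1, v + p.2, r) ∈ S) :
    ∀ᵐ p : X × X, ∀ᵐ t : ℝ, (x t + p.1, e t + p.2, w t) ∈ S := by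
  have hm : Measurable fun q : (X × X) × ℝ => (x q.2 + q.1.1, e q.2 + q.1.2, w q.2) := by fun_prop
  exact (Measure.ae_ae_comm (p := fun (p : X × X) (t : ℝ) =>
    (x t + p.1, e t + p.2, w t) ∈ S) (hm hS)).2 (Eventually.of_forall fun t => h _ _ _)

theorem measurableSet_translate {S : Set (X × X × 𝒰)} (hS : MeasurableSet S) (u v : X) (r : 𝒰) :
    MeasurableSet {p : X × X | (u + p.1, v + p.2, r) ∈ S} := by
  have hm : Measurable fun p : X × X => (u + p.1, v + p.2, r) := by fun_prop
  exact hm hS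

theorem ae_translate_fst {S : Set (X × X × 𝒰)} (hS : MeasurableSet S)
    (h : ∀ y r, ∀ᵐ z, (z, y, r) ∈ S) (u v : X) (r : 𝒰) :
    ∀ᵐ p : X × X, (u + p.1, v + p.2, r) ∈ S := by
  have hm := measurableSet_translate hS u v r
  refine (Measure.ae_prod_iff_ae_ae hm).2 ((Measure.ae_ae_comm
    (p := fun z y : X => (u + z, v + y, r) ∈ S) hm).2 (Eventually.of_forall fun y => ?_))
  exact ae_add_left (h (v + y) r) u

theorem ae_translate_snd {S : Set (X × X × 𝒰)} (hS : MeasurableSet S)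
    (h : ∀ z r, ∀ᵐ y, (z, y, r) ∈ S) (u v : X) (r : 𝒰) :
    ∀ᵐ p : X × X, (u + p.1, v + p.2, r) ∈ S := by
  refine (Measure.ae_prod_iff_ae_ae (measurableSet_translate hS u v r)).2
    (Eventually.of_forall fun z => ?_)
  exact ae_add_left (h (u + z) r) v

variable {f : X → X → 𝒰 → X} {wbar A c ε γ L : ℝ} {V W : X → ℝ} {H : X → X → 𝒰 → ℝ}

/-- The points where `V` and `W` are differentiable and both inequalities hold. -/
def goodSet (f : X → X → 𝒰 → X) (wbar A c ε γ L : ℝ) (V W : X → ℝ) (H : X → X → 𝒰 → ℝ) :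
    Set (X × X × 𝒰) :=
  {q | ‖q.2.2‖ ≤ wbar → (DifferentiableAt ℝ V q.1 ∧ DifferentiableAt ℝ W q.2.1) ∧
    (V q.1 ≤ c → V (q.1 + q.2.1) ≤ c →
      fderiv ℝ W q.2.1 (-f q.1 q.2.1 q.2.2) ≤ L * W q.2.1 + H q.1 q.2.1 q.2.2 ∧
      fderiv ℝ V q.1 (f q.1 q.2.1 q.2.2) ≤
        -ε * V q.1 - H q.1 q.2.1 q.2.2 ^ 2 + γ ^ 2 * W q.2.1 ^ 2 + A)}

theorem LyapunovPair.ae_translate_mem_goodSet (h : LyapunovPair f wbar V A c ε γ L W H)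
    (hf : Continuous fun p : X × X × 𝒰 => f p.1 p.2.1 p.2.2) {x e : ℝ → X} {w : ℝ → 𝒰}
    (hx : Measurable x) (he : Measurable e) (hw : Measurable w) :
    ∀ᵐ p : X × X, ∀ᵐ t : ℝ, (x t + p.1, e t + p.2, w t) ∈ goodSet f wbar A c ε γ L V W H := by
  classical
  have hVm : Measurable V := h.lip_V.continuous.measurable
  have hWm : Measurable W := h.lip_W.continuous.measurable
  have hfm := hf.measurable
  set B : Set (X × X × 𝒰) := {q | ‖q.2.2‖ ≤ wbar} with hB
  have hBm : MeasurableSet B := measurableSet_le (by fun_prop) measurable_const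
  -- H is continuous only for |w| ≤ w̄; extending it by 0 makes it measurable everywhere, as Fubini
  -- requires.
  set H' : X × X × 𝒰 → ℝ := B.piecewise (fun q => H q.1 q.2.1 q.2.2) 0 with hH'
  have hH'm : Measurable H' := h.cont_H.measurable_piecewise continuousOn_const hBm
  have hHeq : ∀ q ∈ B, H' q = H q.1 q.2.1 q.2.2 := fun q hq => B.piecewise_eq_of_mem _ _ hq
  have hl1 : MeasurableSet {q : X × X × 𝒰 | V q.1 ≤ c} :=
    measurableSet_le (by fun_prop) measurable_const
  have hl2 : MeasurableSet {q : X × X × 𝒰 | V (q.1 + q.2.1) ≤ c} :=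
    measurableSet_le (by fun_prop) measurable_const
  have hlevel : MeasurableSet {q : X × X × 𝒰 | V q.1 ≤ c ∧ V (q.1 + q.2.1) ≤ c} := hl1.inter hl2
  set SV : Set (X × X × 𝒰) := {q | q.1 ∈ {x | DifferentiableAt ℝ V x} ∧
    (q ∈ B → q ∈ {q : X × X × 𝒰 | V q.1 ≤ c ∧ V (q.1 + q.2.1) ≤ c} →
      inner ℝ (gradient V q.1) (f q.1 q.2.1 q.2.2) ≤
        -ε * V q.1 - H' q ^ 2 + γ ^ 2 * W q.2.1 ^ 2 + A)} with hSV
  set SW : Set (X × X × 𝒰) := {q | q.2.1 ∈ {x | DifferentiableAt ℝ W x} ∧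
    (q ∈ B → q ∈ {q : X × X × 𝒰 | V q.1 ≤ c ∧ V (q.1 + q.2.1) ≤ c} →
      inner ℝ (gradient W q.2.1) (-f q.1 q.2.1 q.2.2) ≤ L * W q.2.1 + H' q)} with hSW
  have hgV := measurable_gradient V
  have hgW := measurable_gradient W
  have hSVm : MeasurableSet SV := by
    refine (measurable_fst (measurableSet_of_differentiableAt ℝ V)).inter ?_
    refine MeasurableSet.imp hBm (MeasurableSet.imp hlevel (measurableSet_le ?_ ?_))
    · exact (hgV.comp measurable_fst).inner hfm
    · fun_prop
  have hSWm : MeasurableSet SW := by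
    refine (measurable_snd.fst (measurableSet_of_differentiableAt ℝ W)).inter ?_
    refine MeasurableSet.imp hBm (MeasurableSet.imp hlevel (measurableSet_le ?_ ?_))
    · exact (hgW.comp measurable_snd.fst).inner hfm.neg
    · fun_prop
  have h1 := ae_translate hSVm hx he hw (ae_translate_fst hSVm fun y v => by
    by_cases hv : ‖v‖ ≤ wbar
    · filter_upwards [h.lip_V.ae_differentiableAt, h.flow_V y v hv] with z hz hz'
      refine ⟨hz, fun hb hl => ?_⟩
      rw [hHeq _ hb]
      exact hz' hl.1 hl.2
    · filter_upwards [h.lip_V.ae_differentiableAt] with z hz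
      exact ⟨hz, fun hb => absurd hb hv⟩)
  have h2 := ae_translate hSWm hx he hw (ae_translate_snd hSWm fun z v => by
    by_cases hv : ‖v‖ ≤ wbar ∧ V z ≤ c
    · filter_upwards [h.lip_W.ae_differentiableAt, h.flow_W z v hv.2 hv.1] with y hy hy'
      refine ⟨hy, fun hb hl => ?_⟩
      rw [hHeq _ hb]
      exact hy' hl.2
    · filter_upwards [h.lip_W.ae_differentiableAt] with y hy
      exact ⟨hy, fun hb hl => absurd ⟨hb, hl.1⟩ hv⟩)
  filter_upwards [h1, h2] with p hp1 hp2
  filter_upwards [hp1, hp2] with t ht1 ht2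
  intro hb
  refine ⟨⟨ht1.1, ht2.1⟩, fun hl hl' => ⟨?_, ?_⟩⟩
  · have := ht2.2 hb ⟨hl, hl'⟩
    rwa [hHeq _ hb, inner_gradient_eq_fderiv] at this
  · have := ht1.2 hb ⟨hl, hl'⟩
    rwa [hHeq _ hb, inner_gradient_eq_fderiv] at this

theorem IsFlowSegment.ae_translate_mem_goodSet {w : ℝ → 𝒰} {x e : ℝ → X} {xhat : X} {a b : ℝ}
    (hs : IsFlowSegment f wbar w x e xhat a b) (h : LyapunovPair f wbar V A c ε γ L W H)
    (hf : Continuous fun p : X × X × 𝒰 => f p.1 p.2.1 p.2.2) :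
    ∀ᵐ p : X × X, ∀ᵐ t : ℝ, t ∈ Ioo a b →
      (x t + p.1, e t + p.2, w t) ∈ goodSet f wbar A c ε γ L V W H := by
  -- The curves and w are controlled on [a, b] only, so they are replaced by continuous extensions
  -- and a measurable representative, which agree with them there (w up to a null set).
  have hx : Continuous (IccExtend hs.le ((Icc a b).domRestrict x)) :=
    (continuousOn_iff_continuous_domRestrict.1 (by
      simpa [uIcc_of_le hs.le] using hs.ac_x.continuousOn)).Icc_extend'
  have he : Continuous (IccExtend hs.le ((Icc a b).domRestrict e)) :=
    (continuousOn_iff_continuous_domRestrict.1 (by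
      simpa [uIcc_of_le hs.le] using hs.ac_e.continuousOn)).Icc_extend'
  have hw := hs.meas.ae_eq_mk
  rw [Filter.EventuallyEq, ae_restrict_iff' measurableSet_Icc] at hw
  have := h.ae_translate_mem_goodSet hf hx.measurable he.measurable
    hs.meas.stronglyMeasurable_mk.measurable
  filter_upwards [this] with p hp
  filter_upwards [hp, hw] with t ht htw hm
  have hm' := Ioo_subset_Icc_self hm
  rw [← htw hm'] at ht
  rw [IccExtend_of_mem _ _ hm', IccExtend_of_mem _ _ hm'] at ht
  exact ht

end

/-! ## The storage function along translated flow segments -/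

/-- The completion of squares behind the decay of the storage function. -/
theorem storage_deriv_le {v h W dV dW φ dφ ε γ L Λ A M₁ M₂ κ : ℝ} (hγ : 0 < γ) (hφ : 0 < φ)
    (hW : 0 ≤ W) (hΛ : L + ε / 2 ≤ Λ)
    (hV : dV ≤ -ε * v - h ^ 2 + γ ^ 2 * W ^ 2 + A + M₁) (hdW : dW ≤ L * W + h + M₂)
    (hdφ : dφ = -2 * Λ * φ - γ * (φ ^ 2 + 1)) (hM : M₁ + 2 * γ * φ * W * M₂ ≤ κ) :
    dV + γ * (dφ * W ^ 2 + φ * (2 * W * dW)) ≤ -ε * (v + γ * φ * W ^ 2) + (A + κ) := by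
  have h1 : γ * φ * (2 * W) * dW ≤ γ * φ * (2 * W) * (L * W + h + M₂) :=
    mul_le_mul_of_nonneg_left hdW (by positivity)
  have h2 : 0 ≤ 2 * γ * φ * W ^ 2 * (Λ - (L + ε / 2)) :=
    mul_nonneg (by positivity) (by linarith)
  subst hdφ
  -- The term γ²W² cancels against the constant term of the Riccati equation; -h² + 2γφWh - γ²φ²W²
  -- is the square that remains.
  nlinarith [sq_nonneg (h - γ * φ * W)]

section

variable {X 𝒰 : Type*} [NormedAddCommGroup X] [InnerProductSpace ℝ X] [FiniteDimensional ℝ X]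
  [MeasureSpace X] [BorelSpace X] [(volume : Measure X).IsAddHaarMeasure]
  [NormedAddCommGroup 𝒰] [ProperSpace 𝒰] [MeasurableSpace 𝒰] [BorelSpace 𝒰]
  {f : X → X → 𝒰 → X} {wbar A c ε γ L Λ : ℝ} {V W : X → ℝ} {H : X → X → 𝒰 → ℝ}
  {w : ℝ → 𝒰} {x e : ℝ → X} {xhat : X} {a b : ℝ} {φ : ℝ → ℝ}

theorem IsFlowSegment.continuousOn_x (hs : IsFlowSegment f wbar w x e xhat a b) :
    ContinuousOn x (Icc a b) := by
  simpa [uIcc_of_le hs.le] using hs.ac_x.continuousOn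

theorem IsFlowSegment.continuousOn_e (hs : IsFlowSegment f wbar w x e xhat a b) :
    ContinuousOn e (Icc a b) := by
  simpa [uIcc_of_le hs.le] using hs.ac_e.continuousOn

theorem IsFlowSegment.mono (hs : IsFlowSegment f wbar w x e xhat a b) {a' b' : ℝ} (ha : a ≤ a')
    (hab : a' ≤ b') (hb : b' ≤ b) : IsFlowSegment f wbar w x e xhat a' b' where
  le := hab
  ac_x := hs.ac_x.mono (by
    rw [uIcc_of_le hab, uIcc_of_le hs.le]; exact Icc_subset_Icc ha hb)
  ac_e := hs.ac_e.mono (by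
    rw [uIcc_of_le hab, uIcc_of_le hs.le]; exact Icc_subset_Icc ha hb)
  add_eq t ht := hs.add_eq t (Icc_subset_Icc ha hb ht)
  deriv := by
    filter_upwards [hs.deriv] with t ht hm
    exact ht (Ioo_subset_Ioo ha hb hm)
  meas := hs.meas.mono_measure (Measure.restrict_mono (Icc_subset_Icc ha hb) le_rfl)
  bound t ht := hs.bound t (Icc_subset_Icc ha hb ht)

theorem LyapunovPair.W_nonneg (h : LyapunovPair f wbar V A c ε γ L W H) (y : X) : 0 ≤ W y := by
  rcases eq_or_ne y 0 with rfl | hy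
  · exact h.W_zero.ge
  · exact (h.W_pos y hy).le

theorem LyapunovPair.continuous_V (h : LyapunovPair f wbar V A c ε γ L W H) : Continuous V :=
  h.lip_V.continuous

theorem LyapunovPair.continuous_W (h : LyapunovPair f wbar V A c ε γ L W H) : Continuous W :=
  h.lip_W.continuous

theorem LyapunovPair.absolutelyContinuous_storage (h : LyapunovPair f wbar V A c ε γ L W H)
    (hs : IsFlowSegment f wbar w x e xhat a b) (hφ : IsRiccati φ γ Λ a b) (p : X × X) :
    AbsolutelyContinuousOnInterval
      (fun t => storage V W γ φ t (x t + p.1) (e t + p.2)) a b := by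
  have hx : AbsolutelyContinuousOnInterval (fun t => x t + p.1) a b :=
    hs.ac_x.fun_add contDiffOn_const.absolutelyContinuousOnInterval
  have he : AbsolutelyContinuousOnInterval (fun t => e t + p.2) a b :=
    hs.ac_e.fun_add contDiffOn_const.absolutelyContinuousOnInterval
  have hV := h.lip_V.comp_absolutelyContinuousOnInterval hx hx.continuousOn
  have hW := h.lip_W.comp_absolutelyContinuousOnInterval he he.continuousOn
  have := hV.fun_add (((hφ.absolutelyContinuous hs.le).const_mul γ).fun_mul (hW.fun_mul hW))
  simpa [storage, pow_two] using this

theorem LyapunovPair.continuousOn_storage (h : LyapunovPair f wbar V A c ε γ L W H)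
    (hs : IsFlowSegment f wbar w x e xhat a b) (hφ : IsRiccati φ γ Λ a b) :
    ContinuousOn (fun t => storage V W γ φ t (x t) (e t)) (Icc a b) := by
  have := (h.absolutelyContinuous_storage hs hφ 0).continuousOn
  simpa [uIcc_of_le hs.le] using this

theorem exists_norm_sub_lt_of_continuous
    (hf : Continuous fun p : X × X × 𝒰 => f p.1 p.2.1 p.2.2) (R : ℝ) {κ : ℝ} (hκ : 0 < κ) :
    ∃ ρ > 0, ∀ y z y' z' v, ‖y‖ ≤ R → ‖z‖ ≤ R → ‖y'‖ ≤ R → ‖z'‖ ≤ R → ‖v‖ ≤ wbar →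
      ‖y - y'‖ < ρ → ‖z - z'‖ < ρ → ‖f y z v - f y' z' v‖ < κ := by
  have hK : IsCompact (Metric.closedBall (0 : X) R ×ˢ Metric.closedBall (0 : X) R ×ˢ
      Metric.closedBall (0 : 𝒰) wbar) :=
    (isCompact_closedBall _ _).prod ((isCompact_closedBall _ _).prod (isCompact_closedBall _ _))
  have := hK.uniformContinuousOn_of_continuous hf.continuousOn
  rw [Metric.uniformContinuousOn_iff] at this
  obtain ⟨ρ, hρ, h⟩ := this κ hκ
  refine ⟨ρ, hρ, fun y z y' z' v hy hz hy' hz' hv h1 h2 => ?_⟩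
  have := h (y, z, v) (by simp [hy, hz, hv]) (y', z', v) (by simp [hy', hz', hv])
    (by simp [dist_eq_norm, h1, h2])
  simpa [dist_eq_norm] using this

/-- Along almost all small translates of a flow segment, the storage function decays up to a small
error wherever the local condition applies. -/
theorem LyapunovPair.eventually_storage_deriv_le (h : LyapunovPair f wbar V A c ε γ L W H)
    (hf : Continuous fun p : X × X × 𝒰 => f p.1 p.2.1 p.2.2)
    (hs : IsFlowSegment f wbar w x e xhat a b) (hφ : IsRiccati φ γ Λ a b)
    (hΛ : L + ε / 2 ≤ Λ) {κ : ℝ} (hκ : 0 < κ) :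
    ∀ᶠ p : X × X in 𝓝 0 ⊓ ae volume, V (xhat + p.1 + p.2) ≤ c →
      ∀ᵐ t, t ∈ Ioo a b → V (x t + p.1) < c →
        ∃ d, HasDerivAt (fun t => storage V W γ φ t (x t + p.1) (e t + p.2)) d t ∧
          d ≤ -ε * storage V W γ φ t (x t + p.1) (e t + p.2) + (A + κ) := by
  obtain ⟨Rx, hRx⟩ := isCompact_Icc.exists_bound_of_continuousOn hs.continuousOn_x
  obtain ⟨Re, hRe⟩ := isCompact_Icc.exists_bound_of_continuousOn hs.continuousOn_e
  obtain ⟨Φ, hΦ⟩ := isCompact_Icc.exists_bound_of_continuousOn hφ.continuousOn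
  -- The extra 1 leaves room for translations of norm less than 1. The Lipschitz constants below
  -- live on the ball of radius R + 1, a neighbourhood of each translated point, so that they bound
  -- the derivatives.
  set R := max Rx Re + 1 with hR
  have hRx' : Rx + 1 ≤ R := by simp [hR]
  have hRe' : Re + 1 ≤ R := by simp [hR]
  obtain ⟨KV, hKV⟩ := h.lip_V.exists_lipschitzOnWith_of_isCompact
    (isCompact_closedBall (0 : X) (R + 1))
  obtain ⟨KW, hKW⟩ := h.lip_W.exists_lipschitzOnWith_of_isCompact
    (isCompact_closedBall (0 : X) (R + 1))
  obtain ⟨M, hM⟩ := (isCompact_closedBall (0 : X) R).exists_bound_of_continuousOn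
    h.continuous_W.continuousOn
  have hM0 : ∀ y, ‖y‖ ≤ R → W y ≤ |M| := fun y hy =>
    (le_abs_self _).trans ((hM y (by simpa using hy)).trans (le_abs_self M))
  -- Q bounds how strongly an error in the velocity enters the derivative of the storage function,
  -- so a velocity error of κ/Q costs at most κ. The summand 1 keeps Q positive.
  set Q : ℝ := KV + 2 * γ * |Φ| * |M| * KW + 1 with hQ
  have hγ := h.pos_γ
  have hQ0 : 0 < Q := by positivity
  obtain ⟨ρ, hρ, hfρ⟩ := exists_norm_sub_lt_of_continuous (wbar := wbar) hf R
    (show 0 < κ / Q by positivity)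
  have hsmall : ∀ᶠ p : X × X in 𝓝 0 ⊓ ae volume, ‖p‖ < min ρ 1 := by
    have : ∀ᶠ p : X × X in 𝓝 0, ‖p‖ < min ρ 1 := by
      have := Metric.ball_mem_nhds (0 : X × X) (show 0 < min ρ 1 by positivity)
      filter_upwards [this] with p hp
      simpa using hp
    exact this.filter_mono inf_le_left
  have hgood := (hs.ae_translate_mem_goodSet h hf).filter_mono
    (inf_le_right : 𝓝 (0 : X × X) ⊓ ae volume ≤ ae volume)
  filter_upwards [hsmall, hgood] with p hp hpg hxc
  obtain ⟨hp1, hp2⟩ := lt_min_iff.1 hp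
  filter_upwards [hpg, hs.deriv] with t htg htd hm hVc
  have hm' := Ioo_subset_Icc_self hm
  obtain ⟨⟨hdV, hdW⟩, hineq⟩ := htg hm (hs.bound t hm')
  obtain ⟨hxd, hed⟩ := htd hm
  obtain ⟨hφ0, hφd⟩ := hφ t hm'
  have hsum : x t + p.1 + (e t + p.2) = xhat + p.1 + p.2 := by
    rw [← hs.add_eq t hm']; abel
  obtain ⟨hWi, hVi⟩ := hineq hVc.le (by simpa only [hsum] using hxc)
  have hp1' : ‖p.1‖ ≤ ‖p‖ := norm_fst_le p
  have hp2' : ‖p.2‖ ≤ ‖p‖ := norm_snd_le p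
  have nx : ‖x t‖ ≤ R := (hRx t hm').trans (by linarith)
  have ne : ‖e t‖ ≤ R := (hRe t hm').trans (by linarith)
  have nx' : ‖x t + p.1‖ ≤ R := (norm_add_le _ _).trans (by linarith [hRx t hm'])
  have ne' : ‖e t + p.2‖ ≤ R := (norm_add_le _ _).trans (by linarith [hRe t hm'])
  set fv := f (x t) (e t) (w t) with hfv
  set fp := f (x t + p.1) (e t + p.2) (w t) with hfp
  have hdiff : ‖fv - fp‖ ≤ κ / Q := (hfρ _ _ _ _ _ nx ne nx' ne' (hs.bound t hm')
    (by simpa using by linarith) (by simpa using by linarith)).le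
  have hnV : ‖fderiv ℝ V (x t + p.1)‖ ≤ KV := norm_fderiv_le_of_lipschitzOn ℝ
    (Metric.closedBall_mem_nhds_of_mem (by simpa using by linarith)) hKV
  have hnW : ‖fderiv ℝ W (e t + p.2)‖ ≤ KW := norm_fderiv_le_of_lipschitzOn ℝ
    (Metric.closedBall_mem_nhds_of_mem (by simpa using by linarith)) hKW
  have hVt : HasDerivAt (fun t => V (x t + p.1)) (fderiv ℝ V (x t + p.1) fv) t :=
    hdV.hasFDerivAt.comp_hasDerivAt t (hxd.add_const p.1)
  have hWt : HasDerivAt (fun t => W (e t + p.2)) (fderiv ℝ W (e t + p.2) (-fv)) t :=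
    hdW.hasFDerivAt.comp_hasDerivAt t (hed.add_const p.2)
  have hU := hVt.add ((hφd.const_mul γ).mul (hWt.pow 2))
  refine ⟨_, hU, ?_⟩
  have hVb : fderiv ℝ V (x t + p.1) (fv - fp) ≤ KV * (κ / Q) :=
    (le_abs_self _).trans (((fderiv ℝ V (x t + p.1)).le_opNorm _).trans
      (mul_le_mul hnV hdiff (norm_nonneg _) (by positivity)))
  have hWb : fderiv ℝ W (e t + p.2) (-(fv - fp)) ≤ KW * (κ / Q) :=
    (le_abs_self _).trans (((fderiv ℝ W (e t + p.2)).le_opNorm _).trans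
      (mul_le_mul hnW (by rwa [norm_neg]) (norm_nonneg _) (by positivity)))
  have hVs : fderiv ℝ V (x t + p.1) fv =
      fderiv ℝ V (x t + p.1) fp + fderiv ℝ V (x t + p.1) (fv - fp) := by
    rw [← map_add]; congr 1; abel
  have hWs : fderiv ℝ W (e t + p.2) (-fv) =
      fderiv ℝ W (e t + p.2) (-fp) + fderiv ℝ W (e t + p.2) (-(fv - fp)) := by
    rw [← map_add]; congr 1; abel
  have hW0 := h.W_nonneg (e t + p.2)
  have hφΦ : φ t ≤ |Φ| := (le_abs_self _).trans ((hΦ t hm').trans (le_abs_self _))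
  have hsmall : KV * (κ / Q) + 2 * γ * φ t * W (e t + p.2) * (KW * (κ / Q)) ≤ κ := by
    have h1 : φ t * W (e t + p.2) ≤ |Φ| * |M| :=
      mul_le_mul hφΦ (hM0 _ ne') hW0 (abs_nonneg _)
    have h2 : κ / Q * Q = κ := by field_simp
    have h3 : 0 ≤ κ / Q := by positivity
    have h4 : 0 ≤ 2 * γ * (KW * (κ / Q)) := by positivity
    calc KV * (κ / Q) + 2 * γ * φ t * W (e t + p.2) * (KW * (κ / Q))
        = KV * (κ / Q) + 2 * γ * (KW * (κ / Q)) * (φ t * W (e t + p.2)) := by ring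
      _ ≤ KV * (κ / Q) + 2 * γ * (KW * (κ / Q)) * (|Φ| * |M|) + κ / Q := by
        have := mul_le_mul_of_nonneg_left h1 h4
        linarith
      _ = κ / Q * Q := by rw [hQ]; ring
      _ = κ := h2
  have := storage_deriv_le (v := V (x t + p.1)) (h := H (x t + p.1) (e t + p.2) (w t))
    (W := W (e t + p.2)) (dV := fderiv ℝ V (x t + p.1) fv)
    (dW := fderiv ℝ W (e t + p.2) (-fv)) (M₁ := KV * (κ / Q)) (M₂ := KW * (κ / Q)) (A := A)
    hγ hφ0 hW0 hΛ (by rw [hVs]; linarith) (by rw [hWs]; linarith) rfl hsmall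
  refine le_trans (le_of_eq ?_) this
  simp only [Pi.pow_apply]
  push_cast
  ring

theorem LyapunovPair.eventually_storage_le (h : LyapunovPair f wbar V A c ε γ L W H)
    (hf : Continuous fun p : X × X × 𝒰 => f p.1 p.2.1 p.2.2)
    (hs : IsFlowSegment f wbar w x e xhat a b) (hφ : IsRiccati φ γ Λ a b)
    (hΛ : L + ε / 2 ≤ Λ) (hε : ε ≠ 0) {κ : ℝ} (hκ : 0 < κ) :
    ∀ᶠ p : X × X in 𝓝 0 ⊓ ae volume, V (xhat + p.1 + p.2) ≤ c →
      (∀ t ∈ Icc a b, storage V W γ φ t (x t + p.1) (e t + p.2) ≤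
        expBound ε (A + κ) (storage V W γ φ a (x a + p.1) (e a + p.2)) (t - a) →
          V (x t + p.1) < c) →
      ∀ t ∈ Icc a b, storage V W γ φ t (x t + p.1) (e t + p.2) ≤
        expBound ε (A + κ) (storage V W γ φ a (x a + p.1) (e a + p.2)) (t - a) := by
  filter_upwards [h.eventually_storage_deriv_le hf hs hφ hΛ hκ] with p hp hxc hb
  have hc : ContinuousOn (fun t => V (x t + p.1)) (Icc a b) :=
    h.continuous_V.comp_continuousOn (hs.continuousOn_x.add continuousOn_const)
  exact (h.absolutelyContinuous_storage hs hφ p).le_expBound_of_barrier hε hc (hp hxc) hb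

/-! ### From almost all translates back to the segment itself. -/

theorem LyapunovPair.tendsto_storage (h : LyapunovPair f wbar V A c ε γ L W H) (t : ℝ) (y z : X) :
    Tendsto (fun p : X × X => storage V W γ φ t (y + p.1) (z + p.2)) (𝓝 0)
      (𝓝 (storage V W γ φ t y z)) := by
  have hV := h.continuous_V
  have hW := h.continuous_W
  have : Continuous fun p : X × X => storage V W γ φ t (y + p.1) (z + p.2) := by
    unfold storage; fun_prop
  simpa using this.tendsto 0

/-- Nonempty open sets have positive measure, so a set of full measure meets O in every
neighbourhood of a point of its closure; limits along such translations are therefore meaningful. -/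
theorem neBot_nhds_inf_ae_inf_principal {E : Type*} [TopologicalSpace E] [MeasurableSpace E]
    {μ : Measure E} [μ.IsOpenPosMeasure] {O : Set E} (hO : IsOpen O) {p : E} (hp : p ∈ closure O) :
    (𝓝 p ⊓ ae μ ⊓ 𝓟 O).NeBot := by
  rw [inf_right_comm]
  refine inf_neBot_iff.2 fun {s} hs {t} ht => ?_
  obtain ⟨N, hNs, hN⟩ := mem_nhds_iff.1 (mem_inf_principal.1 hs)
  by_contra hcon
  rw [not_nonempty_iff_eq_empty] at hcon
  have hsub : N ∩ O ⊆ tᶜ := fun q hq hqt => by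
    have : q ∈ s ∩ t := ⟨hNs hq.1 hq.2, hqt⟩
    rw [hcon] at this
    exact this
  have hne := mem_closure_iff.1 hp N hN.1 hN.2
  exact ((hN.1.inter hO).measure_pos μ hne).ne' (measure_mono_null hsub ht)

/-- If almost all translates in an open set that accumulates at `0` satisfy the bounds up to a small
error, then the segment itself satisfies the bound. -/
theorem LyapunovPair.storage_le_of_translates (h : LyapunovPair f wbar V A c ε γ L W H)
    {O : Set (X × X)} (hO : IsOpen O) (h0 : 0 ∈ closure O) {t : ℝ}
    (hb : ∀ᶠ κ : ℝ in 𝓝[>] 0, ∀ᶠ p : X × X in 𝓝 0 ⊓ ae volume, p ∈ O →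
      storage V W γ φ t (x t + p.1) (e t + p.2) ≤
        expBound ε (A + κ) (storage V W γ φ a (x a + p.1) (e a + p.2)) (t - a)) :
    storage V W γ φ t (x t) (e t) ≤ expBound ε A (storage V W γ φ a (x a) (e a)) (t - a) := by
  have h1 : ∀ᶠ κ : ℝ in 𝓝[>] 0, storage V W γ φ t (x t) (e t) ≤
      expBound ε (A + κ) (storage V W γ φ a (x a) (e a)) (t - a) := by
    filter_upwards [hb] with κ hκ
    have hne : (𝓝 (0 : X × X) ⊓ ae volume ⊓ 𝓟 O).NeBot :=
      neBot_nhds_inf_ae_inf_principal hO h0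
    have hle : 𝓝 (0 : X × X) ⊓ ae volume ⊓ 𝓟 O ≤ 𝓝 0 := inf_le_left.trans inf_le_left
    refine le_of_tendsto_of_tendsto ((h.tendsto_storage t (x t) (e t)).mono_left hle) ?_
      (eventually_inf_principal.2 hκ)
    have h2 : Continuous fun u => expBound ε (A + κ) u (t - a) := by unfold expBound; fun_prop
    exact (h2.tendsto _).comp ((h.tendsto_storage a (x a) (e a)).mono_left hle)
  have h3 : Continuous fun κ =>
      expBound ε (A + κ) (storage V W γ φ a (x a) (e a)) (t - a) := by unfold expBound; fun_prop
  have h4 := (h3.tendsto 0).mono_left (nhdsWithin_le_nhds (s := Ioi 0))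
  rw [add_zero] at h4
  exact ge_of_tendsto h4 h1

theorem isOpen_translates (hV : Continuous V) :
    IsOpen {p : X × X | V (xhat + p.1 + p.2) < c} :=
  isOpen_lt (by fun_prop) continuous_const

theorem zero_mem_closure_translates (hx : xhat ∈ closure {y | V y < c}) :
    (0 : X × X) ∈ closure {p : X × X | V (xhat + p.1 + p.2) < c} := by
  have hc : Continuous fun q : X => ((0 : X), q - xhat) := by fun_prop
  have := map_mem_closure hc hx (t := {p : X × X | V (xhat + p.1 + p.2) < c}) (fun q hq => by
    simpa using hq)
  rw [sub_self] at this
  exact this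

/-- As long as the segment stays in the open sublevel set, the storage function decays. -/
theorem LyapunovPair.storage_le_of_lt (h : LyapunovPair f wbar V A c ε γ L W H)
    (hf : Continuous fun p : X × X × 𝒰 => f p.1 p.2.1 p.2.2)
    (hs : IsFlowSegment f wbar w x e xhat a b) (hφ : IsRiccati φ γ Λ a b)
    (hΛ : L + ε / 2 ≤ Λ) (hε : ε ≠ 0) (hx : xhat ∈ closure {y | V y < c})
    (hlt : ∀ t ∈ Icc a b, V (x t) < c) :
    ∀ t ∈ Icc a b,
      storage V W γ φ t (x t) (e t) ≤ expBound ε A (storage V W γ φ a (x a) (e a)) (t - a) := by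
  intro t ht
  refine h.storage_le_of_translates (isOpen_translates h.continuous_V)
    (zero_mem_closure_translates hx) ?_
  have hV := h.continuous_V
  -- The image of [a, b] is compact in {V < c}, so all small translates stay there and the barrier
  -- hypothesis holds for free.
  have hev : ∀ᶠ p : X × X in 𝓝 0, ∀ u ∈ x '' Icc a b, V (u + p.1) < c := by
    refine (isCompact_Icc.image_of_continuousOn hs.continuousOn_x).eventually_forall_of_forall_eventually
      ?_
    rintro _ ⟨s, hs', rfl⟩
    have hc : Continuous fun q : (X × X) × X => V (q.2 + q.1.1) := by fun_prop
    have := (hc.tendsto (0, x s)).eventually (eventually_lt_nhds (b := c) (by simpa using hlt s hs'))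
    exact this
  filter_upwards [self_mem_nhdsWithin] with κ hκ
  filter_upwards [h.eventually_storage_le hf hs hφ hΛ hε hκ, hev.filter_mono inf_le_left]
    with p hp hp' hpO
  exact hp (le_of_lt hpO) (fun s hs' _ => hp' _ (mem_image_of_mem x hs')) t ht

/-- If the bound stays below the level `c`, then the segment stays in the open sublevel set. -/
theorem LyapunovPair.storage_le_of_expBound_lt (h : LyapunovPair f wbar V A c ε γ L W H)
    (hf : Continuous fun p : X × X × 𝒰 => f p.1 p.2.1 p.2.2)
    (hs : IsFlowSegment f wbar w x e xhat a b) (hφ : IsRiccati φ γ Λ a b)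
    (hΛ : L + ε / 2 ≤ Λ) (hε : ε ≠ 0) (hx : xhat ∈ closure {y | V y < c})
    (hlt : ∀ t ∈ Icc a b, expBound ε A (storage V W γ φ a (x a) (e a)) (t - a) < c) :
    ∀ t ∈ Icc a b,
      storage V W γ φ t (x t) (e t) ≤ expBound ε A (storage V W γ φ a (x a) (e a)) (t - a) := by
  intro t ht
  refine h.storage_le_of_translates (isOpen_translates h.continuous_V)
    (zero_mem_closure_translates hx) ?_
  have hV := h.continuous_V
  have hW := h.continuous_W
  -- The strict bound on a compact interval survives small perturbations of both κ and p, uniformly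
  -- in time. The barrier argument then closes, because V is at most the storage function.
  have hev : ∀ᶠ q : ℝ × X × X in 𝓝 0, ∀ s ∈ Icc a b,
      expBound ε (A + q.1) (storage V W γ φ a (x a + q.2.1) (e a + q.2.2)) (s - a) < c := by
    refine isCompact_Icc.eventually_forall_of_forall_eventually fun s hs' => ?_
    have hc : Continuous fun q : (ℝ × X × X) × ℝ => expBound ε (A + q.1.1)
        (storage V W γ φ a (x a + q.1.2.1) (e a + q.1.2.2)) (q.2 - a) := by
      unfold expBound storage; fun_prop
    exact (hc.tendsto (0, s)).eventually (eventually_lt_nhds (b := c) (by simpa using hlt s hs'))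
  have hev' : ∀ᶠ κ : ℝ in 𝓝 0, ∀ᶠ p : X × X in 𝓝 0, ∀ s ∈ Icc a b,
      expBound ε (A + κ) (storage V W γ φ a (x a + p.1) (e a + p.2)) (s - a) < c :=
    Filter.Eventually.curry_nhds (x := (0 : ℝ)) (y := (0 : X × X)) hev
  filter_upwards [self_mem_nhdsWithin, hev'.filter_mono nhdsWithin_le_nhds] with κ hκ hκ'
  filter_upwards [h.eventually_storage_le hf hs hφ hΛ hε hκ, hκ'.filter_mono inf_le_left]
    with p hp hp' hpO
  refine hp (le_of_lt hpO) (fun s hs' hle => ?_) t ht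
  exact ((le_storage h.pos_γ.le (hφ s hs').1.le _ _).trans hle).trans_lt (hp' s hs')

/-- A segment that starts on the boundary of the sublevel set with a vanishing error. -/
theorem LyapunovPair.storage_le_of_start_le (h : LyapunovPair f wbar V A c ε γ L W H)
    (hf : Continuous fun p : X × X × 𝒰 => f p.1 p.2.1 p.2.2)
    (hs : IsFlowSegment f wbar w x e xhat a b) (hφ : IsRiccati φ γ Λ a b)
    (hΛ : L + ε / 2 ≤ Λ) (hε : 0 < ε) (hx : xhat ∈ closure {y | V y < c}) (he : e a = 0)
    (hA : A / ε < c) :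
    ∀ t ∈ Icc a b,
      storage V W γ φ t (x t) (e t) ≤ expBound ε A (storage V W γ φ a (x a) (e a)) (t - a) := by
  intro t ht
  have hV := h.continuous_V
  have hW := h.continuous_W
  have hxa : x a = xhat := by
    have := hs.add_eq a (left_mem_Icc.2 hs.le)
    rwa [he, add_zero] at this
  set O : Set (X × X) := {p | V (xhat + p.1 + p.2) < c} ∩
    -- The bound may start at c, so the translates are also required to start strictly below it. The
    -- translations (q - x̂, 0) with V q < c keep the initial error zero, meet both requirements and
    -- accumulate at 0.
    {p | storage V W γ φ a (x a + p.1) (e a + p.2) < c} with hO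
  have hOo : IsOpen O := (isOpen_translates hV).inter
    (isOpen_lt (by unfold storage; fun_prop) continuous_const)
  have h0 : (0 : X × X) ∈ closure O := by
    have hc : Continuous fun q : X => (q - xhat, (0 : X)) := by fun_prop
    have := map_mem_closure hc hx (t := O) (fun q hq => by
      have hq' : V q < c := hq
      refine ⟨by simpa using hq', ?_⟩
      simp [hxa, he, storage, h.W_zero, hq'])
    rw [sub_self] at this
    exact this
  refine h.storage_le_of_translates hOo h0 ?_
  have hev : ∀ᶠ κ : ℝ in 𝓝 0, (A + κ) / ε < c := by
    have hc : Continuous fun κ : ℝ => (A + κ) / ε := by fun_prop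
    exact (hc.tendsto 0).eventually (eventually_lt_nhds (by simpa using hA))
  filter_upwards [self_mem_nhdsWithin, hev.filter_mono nhdsWithin_le_nhds] with κ hκ hκ'
  filter_upwards [h.eventually_storage_le hf hs hφ hΛ hε.ne' hκ] with p hp hpO
  refine hp (le_of_lt hpO.1) (fun s hs' hle => ?_) t ht
  refine ((le_storage h.pos_γ.le (hφ s hs').1.le _ _).trans hle).trans_lt ?_
  exact (expBound_le_max hε (by linarith [hs'.1])).trans_lt (max_lt hpO.2 hκ')

end

/-! ## The interval between two samples -/

theorem exists_isRiccati {γ Λ δ a b : ℝ} (hγ : 0 < γ) (hΛ : 0 < Λ) (hδ : δ < 1)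
    (hb : b - a ≤ δ * Tmax γ Λ) : ∃ φ, IsRiccati φ γ Λ a b := by
  have hT := Tmax_pos hγ hΛ
  obtain ⟨φ, hφ⟩ := exists_riccati (T := b - a) hγ hΛ (by nlinarith)
  have h : IsRiccati φ γ Λ 0 (b - a) := hφ
  have := h.shift a
  rw [add_sub_cancel] at this
  exact ⟨_, this⟩

theorem sub_le_exp_mul_of_le_expBound {ε β u s v cw : ℝ} (hε : 0 < ε) (hs : 0 ≤ s)
    (hβ : β / ε ≤ cw) (h : v ≤ expBound ε β u s) :
    v - cw ≤ Real.exp (-ε * s) * max (u - cw) 0 := by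
  have h1 : Real.exp (-ε * s) ≤ 1 := Real.exp_le_one_iff.2 (by nlinarith)
  have h2 := Real.exp_pos (-ε * s)
  rw [expBound] at h
  have h3 := mul_le_mul_of_nonneg_left (le_max_left (u - cw) 0) h2.le
  nlinarith

section

variable {X 𝒰 : Type*} [NormedAddCommGroup X] [InnerProductSpace ℝ X] [FiniteDimensional ℝ X]
  [MeasureSpace X] [BorelSpace X] [(volume : Measure X).IsAddHaarMeasure]
  [NormedAddCommGroup 𝒰] [ProperSpace 𝒰] [MeasurableSpace 𝒰] [BorelSpace 𝒰]
  {f : X → X → 𝒰 → X} {wbar A c ε γ L Λ : ℝ} {V W : X → ℝ} {H : X → X → 𝒰 → ℝ}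
  {c' ε' γ' L' : ℝ} {W' : X → ℝ} {H' : X → X → 𝒰 → ℝ}
  {w : ℝ → 𝒰} {x e : ℝ → X} {xhat : X} {a b : ℝ} {φ : ℝ → ℝ}

theorem IsClassKInf.pos {α : ℝ → ℝ} (h : IsClassKInf α) {r : ℝ} (hr : 0 < r) : 0 < α r := by
  have := h.1.2.1 (mem_Ici.2 le_rfl) (mem_Ici.2 hr.le) hr
  rwa [h.1.2.2] at this

theorem LocalHybridLyapunov.exists_lyapunovPair {αw : ℝ → ℝ}
    (h : LocalHybridLyapunov f wbar V αw c ε γ L) :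
    ∃ W H, LyapunovPair f wbar V (αw wbar) c ε γ L W H := by
  obtain ⟨-, hγ, hV, hα, W, H, αWl, αWu, αVl, αVu, hW, hH, -, hWl, hWu, -, -, hWb, -, h1, h2⟩ := h
  refine ⟨W, H, hγ, hV, hW, hH, ?_, fun e he => ?_, h1, fun e v hv => ?_⟩
  · have := hWb 0
    rw [norm_zero, hWl.1.2.2, hWu.1.2.2] at this
    exact le_antisymm this.2 this.1
  · exact (hWl.pos (norm_pos_iff.2 he)).trans_le (hWb e).1
  · filter_upwards [h2 e v hv] with y hy hy1 hy2
    have h3 : αw ‖v‖ ≤ αw wbar := hα.1.2.1.monotoneOn (mem_Ici.2 (norm_nonneg v))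
      (mem_Ici.2 ((norm_nonneg v).trans hv)) hv
    linarith [hy hy1 hy2]

theorem IsFlowSegment.x_eq (hs : IsFlowSegment f wbar w x e xhat a b) {t : ℝ} (ht : t ∈ Icc a b)
    (he : e t = 0) : x t = xhat := by
  have := hs.add_eq t ht
  rwa [he, add_zero] at this

theorem LyapunovPair.storage_eq (h : LyapunovPair f wbar V A c ε γ L W H) {t : ℝ} {y z : X}
    (hz : z = 0) : storage V W γ φ t y z = V y := by
  simp [storage, hz, h.W_zero]

theorem IsFlowSegment.mem_closure_of_lt (hs : IsFlowSegment f wbar w x e xhat a b) (hab : a < b)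
    (he : e a = 0) (h : ∀ t ∈ Ioc a b, V (x t) < c) : xhat ∈ closure {y | V y < c} := by
  have ha : a ∈ Icc a b := left_mem_Icc.2 hab.le
  rw [← hs.x_eq ha he]
  have hc : ContinuousWithinAt x (Ioc a b) a :=
    (hs.continuousOn_x a ha).mono Ioc_subset_Icc_self
  exact hc.mem_closure (by rw [closure_Ioc hab.ne]; exact ha) h

/-- A segment that starts with a vanishing error at or below the level `c ≥ A/ε` stays there if the
local condition holds also on a larger sublevel set: it could leave only at a time when the error
vanishes, and the condition on the larger set prevents this. -/
theorem LyapunovPair.le_level (h : LyapunovPair f wbar V A c ε γ L W H)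
    (h' : LyapunovPair f wbar V A c' ε' γ' L' W' H') (hcc : c < c')
    (hf : Continuous fun p : X × X × 𝒰 => f p.1 p.2.1 p.2.2)
    (hs : IsFlowSegment f wbar w x e xhat a b) (hφ : IsRiccati φ γ Λ a b)
    (hΛ : L + ε / 2 ≤ Λ) (hε : 0 < ε) (hε' : 0 < ε') (hL' : 0 < L') (hA : A / ε ≤ c)
    (hA' : A / ε' ≤ c) (he : e a = 0) (hV : V xhat ≤ c) : ∀ t ∈ Icc a b, V (x t) ≤ c := by
  by_contra! hcon
  obtain ⟨t₂, ht₂, hgt⟩ := hcon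
  have hcpt : IsCompact (Icc a t₂ ∩ e ⁻¹' {0}) :=
    isCompact_Icc.of_isClosed_subset
      ((hs.continuousOn_e.mono (Icc_subset_Icc_right ht₂.2)).preimage_isClosed_of_isClosed
        isClosed_Icc isClosed_singleton) inter_subset_left
  -- `s` is the last zero of e up to t₂, so x s = x̂. After `s` the error is nonzero, and W(e) > 0
  -- turns a bound of the storage function by c into V < c.
  obtain ⟨s, hsm, hsmax⟩ := hcpt.exists_isGreatest ⟨a, left_mem_Icc.2 ht₂.1, he⟩
  have hes : e s = 0 := hsm.2
  have hsI : s ∈ Icc a b := ⟨hsm.1.1, hsm.1.2.trans ht₂.2⟩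
  have hst : s < t₂ := by
    refine lt_of_le_of_ne hsm.1.2 fun heq => ?_
    rw [← heq, hs.x_eq hsI hes] at hgt
    exact absurd hV (not_le.2 hgt)
  have hne : ∀ t ∈ Ioc s t₂, e t ≠ 0 := fun t ht h0 =>
    absurd (hsmax ⟨⟨hsm.1.1.trans ht.1.le, ht.2⟩, h0⟩) (not_le.2 ht.1)
  have hγ' := h'.pos_γ
  have hΛ' : 0 < L' + ε' / 2 := by positivity
  have hT := Tmax_pos hγ' hΛ'
  -- The condition on the larger set is used only on a short interval after `s`, where its own φ'
  -- exists; the factor 1/2 is arbitrary. It pushes V strictly below c and thereby puts x̂ into the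
  -- closure of {V < c}.
  set b' := min t₂ (s + 1 / 2 * Tmax γ' (L' + ε' / 2)) with hb'
  have hsb : s < b' := lt_min hst (by linarith)
  have hbt : b' ≤ t₂ := min_le_left _ _
  obtain ⟨φ', hφ'⟩ := exists_isRiccati (a := s) (b := b') hγ' hΛ' (δ := 1 / 2) (by norm_num)
    (by linarith [min_le_right t₂ (s + 1 / 2 * Tmax γ' (L' + ε' / 2))])
  have hs' := hs.mono hsI.1 hsb.le (hbt.trans ht₂.2)
  have hle' : ∀ t ∈ Icc s b', storage V W' γ' φ' t (x t) (e t) ≤ c := by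
    have hbd : ∀ t ∈ Icc s b',
        expBound ε' A (storage V W' γ' φ' s (x s) (e s)) (t - s) ≤ c := fun t ht => by
      refine (expBound_le_max hε' (by linarith [ht.1])).trans (max_le ?_ hA')
      rwa [h'.storage_eq hes, hs.x_eq hsI hes]
    exact fun t ht => (h'.storage_le_of_expBound_lt hf hs' hφ' le_rfl hε'.ne'
      (subset_closure (hV.trans_lt hcc)) (fun t ht => (hbd t ht).trans_lt hcc) t ht).trans
        (hbd t ht)
  have hlt' : ∀ t ∈ Ioc s b', V (x t) < c := fun t ht => by
    have h1 := hle' t (Ioc_subset_Icc_self ht)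
    have h2 := h'.W_pos _ (hne t ⟨ht.1, ht.2.trans hbt⟩)
    have h3 := (hφ' t (Ioc_subset_Icc_self ht)).1
    have : 0 < γ' * φ' t * W' (e t) ^ 2 := by positivity
    simp only [storage] at h1
    linarith
  have hclos := hs'.mem_closure_of_lt hsb hes hlt'
  have hVx : ContinuousOn (fun t => V (x t)) (Icc a b) :=
    h.continuous_V.comp_continuousOn hs.continuousOn_x
  have hcpt' : IsCompact (Icc b' t₂ ∩ (fun t => V (x t)) ⁻¹' Ici c) :=
    isCompact_Icc.of_isClosed_subset
      ((hVx.mono (Icc_subset_Icc (hsI.1.trans hsb.le) ht₂.2)).preimage_isClosed_of_isClosed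
        isClosed_Icc isClosed_Ici) inter_subset_left
  obtain ⟨T, hTm, hTmin⟩ := hcpt'.exists_isLeast ⟨t₂, right_mem_Icc.2 hbt, hgt.le⟩
  have hTc : c ≤ V (x T) := hTm.2
  have hsT : s < T := hsb.trans_le hTm.1.1
  have hltT : ∀ t ∈ Ioo s T, V (x t) < c := fun t ht => by
    rcases le_or_gt t b' with htb | htb
    · exact hlt' t ⟨ht.1, htb⟩
    · by_contra hcon
      exact absurd (hTmin ⟨⟨htb.le, ht.2.le.trans hTm.1.2⟩, not_lt.1 hcon⟩) (not_le.2 ht.2)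
  have hTI : T ∈ Icc a b := ⟨hsI.1.trans hsT.le, hTm.1.2.trans ht₂.2⟩
  have hcs := h.continuousOn_storage hs hφ
  -- On (s, T) the segment stays in {V < c}, so the condition at level c applies on [p, t] for every
  -- p > s; letting p tend to s, the starting value becomes V(x̂) ≤ c. Afterwards t tends to T,
  -- where W(e T) > 0 contradicts V(x T) ≥ c.
  have hle : ∀ t ∈ Ioo s T, storage V W γ φ t (x t) (e t) ≤ c := fun t ht => by
    have h1 : ∀ᶠ p in 𝓝[>] s, storage V W γ φ t (x t) (e t) ≤
        max (storage V W γ φ p (x p) (e p)) c := by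
      filter_upwards [Ioo_mem_nhdsGT ht.1] with p hp
      have hps := hs.mono (hsI.1.trans hp.1.le) hp.2.le (ht.2.le.trans hTI.2)
      refine (h.storage_le_of_lt hf hps
        (hφ.mono (hsI.1.trans hp.1.le) (ht.2.le.trans hTI.2)) hΛ hε.ne' hclos
        (fun u hu => hltT u ⟨hp.1.trans_le hu.1, hu.2.trans_lt ht.2⟩) t
        (right_mem_Icc.2 hp.2.le)).trans ?_
      exact (expBound_le_max hε (by linarith [hp.2])).trans (max_le_max le_rfl hA)
    have h2 : Tendsto (fun p => max (storage V W γ φ p (x p) (e p)) c) (𝓝[>] s)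
        (𝓝 (max (storage V W γ φ s (x s) (e s)) c)) := by
      refine Tendsto.max ?_ tendsto_const_nhds
      exact (hcs s hsI).mono_left (nhdsWithin_le_of_mem (mem_of_superset
        (Ioo_mem_nhdsGT hsT) fun u hu => ⟨hsI.1.trans hu.1.le, hu.2.le.trans hTI.2⟩))
    have h3 := ge_of_tendsto h2 h1
    rwa [h.storage_eq hes, hs.x_eq hsI hes, max_eq_right hV] at h3
  have hleT : storage V W γ φ T (x T) (e T) ≤ c := by
    have h2 : Tendsto (fun p => storage V W γ φ p (x p) (e p)) (𝓝[<] T)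
        (𝓝 (storage V W γ φ T (x T) (e T))) :=
      (hcs T hTI).mono_left (nhdsWithin_le_of_mem (mem_of_superset
        (Ioo_mem_nhdsLT hsT) fun u hu => ⟨hsI.1.trans hu.1.le, hu.2.le.trans hTI.2⟩))
    refine le_of_tendsto h2 ?_
    filter_upwards [Ioo_mem_nhdsLT hsT] with t ht using hle t ht
  have h2 := h.W_pos _ (hne T ⟨hsT, hTm.1.2⟩)
  have h3 := (hφ T hTI).1
  have h4 := h.pos_γ
  have : 0 < γ * φ T * W (e T) ^ 2 := by positivity
  simp only [storage] at hleT
  linarith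

/-- Decay towards `c_w` for a parameter set with `ε > 0`. -/
theorem LyapunovPair.sub_le_exp_mul (h : LyapunovPair f wbar V A c ε γ L W H)
    (hf : Continuous fun p : X × X × 𝒰 => f p.1 p.2.1 p.2.2)
    (hs : IsFlowSegment f wbar w x e xhat a b) (hε : 0 < ε) (hL : 0 < L) {δ cw : ℝ} (hδ : δ < 1)
    (hb : b - a ≤ δ * Tmax γ (L + ε / 2)) (he : e a = 0) (hA : A / ε ≤ cw) (hcw : cw ≤ c)
    (hV : V xhat ≤ c)
    (htop : V xhat = c → (A / ε < c ∧ xhat ∈ closure {y | V y < c}) ∨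
      ∃ c' ε' γ' L' W' H', LyapunovPair f wbar V A c' ε' γ' L' W' H' ∧ c < c' ∧ 0 < ε' ∧ 0 < L' ∧
        A / ε' ≤ cw) :
    ∀ t ∈ Icc a b, V (x t) - cw ≤ Real.exp (-ε * (t - a)) * max (V xhat - cw) 0 := by
  obtain ⟨φ, hφ⟩ := exists_isRiccati h.pos_γ (show 0 < L + ε / 2 by positivity) hδ hb
  have haI : a ∈ Icc a b := left_mem_Icc.2 hs.le
  have hxa := hs.x_eq haI he
  have hstart : storage V W γ φ a (x a) (e a) = V xhat := by rw [h.storage_eq he, hxa]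
  have hfin : (∀ t ∈ Icc a b, storage V W γ φ t (x t) (e t) ≤
      expBound ε A (storage V W γ φ a (x a) (e a)) (t - a)) →
      ∀ t ∈ Icc a b, V (x t) - cw ≤ Real.exp (-ε * (t - a)) * max (V xhat - cw) 0 :=
    fun hst t ht => sub_le_exp_mul_of_le_expBound hε (by linarith [ht.1]) hA
      ((le_storage h.pos_γ.le (hφ t ht).1.le _ _).trans ((hst t ht).trans_eq (by rw [hstart])))
  rcases hV.lt_or_eq with hlt | heq
  · refine hfin (h.storage_le_of_expBound_lt hf hs hφ le_rfl hε.ne' (subset_closure hlt)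
      fun t ht => ?_)
    rw [hstart]
    exact expBound_lt' hε (by linarith [ht.1]) hlt (hA.trans hcw)
  · rcases htop heq with ⟨hAc, hcl⟩ | ⟨c', ε', γ', L', W', H', h', hcc, hε', hL', hA'⟩
    · exact hfin (h.storage_le_of_start_le hf hs hφ le_rfl hε hcl he hAc)
    · rcases hcw.eq_or_lt with rfl | hlt
      -- Here c_w = c, so α_w(w̄)/ε may equal c and strict decrease may fail; but it suffices to
      -- show V ≤ c.
      · intro t ht
        have := h.le_level h' hcc hf hs hφ le_rfl hε hε' hL' hA hA' he hV t ht
        have h2 : 0 ≤ Real.exp (-ε * (t - a)) * max (V xhat - cw) 0 := by positivity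
        linarith
      · rcases hs.le.eq_or_lt with rfl | hab
        · intro t ht
          obtain rfl : t = a := le_antisymm ht.2 ht.1
          simp [hxa]
        · have hγ' := h'.pos_γ
          have hΛ' : 0 < L' + ε' / 2 := by positivity
          have hT := Tmax_pos hγ' hΛ'
          -- As α_w(w̄)/ε' ≤ c_w < c, the condition on the larger set forces V < c immediately after
          -- a, which places x̂ in the closure of {V < c}.
          set b' := min b (a + 1 / 2 * Tmax γ' (L' + ε' / 2)) with hb'
          have hab' : a < b' := lt_min hab (by linarith)
          obtain ⟨φ', hφ'⟩ := exists_isRiccati (a := a) (b := b') hγ' hΛ' (δ := 1 / 2)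
            (by norm_num) (by linarith [min_le_right b (a + 1 / 2 * Tmax γ' (L' + ε' / 2))])
          have hs' := hs.mono le_rfl hab'.le (min_le_left _ _)
          have hstart' : storage V W' γ' φ' a (x a) (e a) = V xhat := by
            rw [h'.storage_eq he, hxa]
          have hst := h'.storage_le_of_expBound_lt hf hs' hφ' le_rfl hε'.ne'
            (subset_closure (hV.trans_lt hcc)) fun t ht => by
              rw [hstart']
              exact expBound_lt' hε' (by linarith [ht.1]) (hV.trans_lt hcc) (by linarith)
          have hcl : xhat ∈ closure {y | V y < c} := by
            refine hs'.mem_closure_of_lt hab' he fun t ht => ?_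
            have ht' := Ioc_subset_Icc_self ht
            refine ((le_storage hγ'.le (hφ' t ht').1.le _ _).trans (hst t ht')).trans_lt ?_
            rw [hstart']
            exact expBound_lt hε' (by linarith [ht.1]) hV (hA'.trans_lt hlt)
          exact hfin (h.storage_le_of_start_le hf hs hφ le_rfl hε hcl he (hA.trans_lt hlt))

/-- Exponentiated, the logarithmic bound reads e^{(ε_ref - ε)s} (v - A/ε) ≤ C - A/ε. Multiplied by
e^{-ε_ref s}, it leaves the remainder (A/ε)(1 - e^{-ε_ref s}), which is nonpositive because ε < 0.
-/
theorem expBound_le_exp_mul {ε εref A v C s h : ℝ} (hε : ε < 0) (hεref : 0 < εref) (hA : 0 < A)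
    (hv : 0 ≤ v) (hC : 0 ≤ C) (hs : 0 ≤ s) (hsh : s ≤ h)
    (hh : h ≤ (Real.log (C - A / ε) - Real.log (v - A / ε)) / (-ε + εref)) :
    expBound ε A v s ≤ Real.exp (-εref * s) * C := by
  have hq : A / ε < 0 := div_neg_of_pos_of_neg hA hε
  have h1 : 0 < v - A / ε := by linarith
  have h2 : 0 < C - A / ε := by linarith
  have h3 : s * (-ε + εref) + Real.log (v - A / ε) ≤ Real.log (C - A / ε) := by
    have := (le_div_iff₀ (by linarith)).1 (hsh.trans hh)
    linarith
  have h4 : Real.exp (s * (-ε + εref)) * (v - A / ε) ≤ C - A / ε := by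
    have := Real.exp_le_exp.2 h3
    rwa [Real.exp_add, Real.exp_log h1, Real.exp_log h2] at this
  have h5 := mul_le_mul_of_nonneg_left h4 (Real.exp_pos (-εref * s)).le
  rw [← mul_assoc, ← Real.exp_add, show -εref * s + s * (-ε + εref) = -ε * s by ring] at h5
  have h6 : Real.exp (-εref * s) ≤ 1 := Real.exp_le_one_iff.2 (by nlinarith)
  rw [expBound]
  nlinarith

/-- Decay along the reference `e^{-ε_ref t} C` for a parameter set with `ε < 0`. -/
theorem LyapunovPair.le_exp_mul (h : LyapunovPair f wbar V A c ε γ L W H)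
    (hf : Continuous fun p : X × X × 𝒰 => f p.1 p.2.1 p.2.2)
    (hs : IsFlowSegment f wbar w x e xhat a b) (hε : ε < 0) {δ εref C : ℝ} (hεref : 0 < εref)
    (hδ₁ : δ < 1) (hA : 0 < A) (hVx : 0 ≤ V xhat) (he : e a = 0) (hC : C ≤ c)
    (hpos : 0 < candidateInterval δ εref A (V xhat) C ε γ L)
    (hb : b - a ≤ candidateInterval δ εref A (V xhat) C ε γ L) :
    V xhat < C ∧ ∀ t ∈ Icc a b, V (x t) ≤ Real.exp (-εref * (t - a)) * C := by
  have hVC : V xhat ≤ C := by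
    by_contra hcon
    simp [candidateInterval, hcon] at hpos
  have hεε : 0 < -ε + εref := by linarith
  rw [candidateInterval, if_pos hVC, if_pos hεε] at hpos hb
  have hq : A / ε < 0 := div_neg_of_pos_of_neg hA hε
  -- At V(x̂) = C the logarithms cancel and the candidate would not be positive.
  have hlt : V xhat < C := by
    have := (div_pos_iff_of_pos_right hεε).1 (lt_min_iff.1 hpos).2
    have := (Real.log_lt_log_iff (by linarith) (by linarith)).1 (sub_pos.1 this)
    linarith
  have hC0 : 0 < C := hVx.trans_lt hlt
  -- For ε < 0 the number L + ε/2 may fail to be positive. The floor 1 - δ keeps Λ positive, and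
  -- enlarging Λ does not harm the decay of the storage function.
  obtain ⟨φ, hφ⟩ := exists_isRiccati h.pos_γ
    (show 0 < max (L + ε / 2) (1 - δ) from lt_max_of_lt_right (by linarith)) hδ₁
    (hb.trans (min_le_left _ _))
  have haI : a ∈ Icc a b := left_mem_Icc.2 hs.le
  have hstart : storage V W γ φ a (x a) (e a) = V xhat := by
    rw [h.storage_eq he, hs.x_eq haI he]
  have hle : ∀ t ∈ Icc a b, expBound ε A (V xhat) (t - a) ≤ Real.exp (-εref * (t - a)) * C :=
    fun t ht => expBound_le_exp_mul hε hεref hA hVx hC0.le (by linarith [ht.1])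
      (by linarith [ht.2]) (hb.trans (min_le_right _ _))
  refine ⟨hlt, fun t ht => ?_⟩
  have hst := h.storage_le_of_expBound_lt hf hs hφ (le_max_left _ _) hε.ne
    (subset_closure (hlt.trans_le hC)) fun t ht => by
      rw [hstart]
      rcases ht.1.eq_or_lt with rfl | hat
      · rw [sub_self, expBound_zero]; exact hlt.trans_le hC
      · refine (hle t ht).trans_lt (lt_of_lt_of_le ?_ hC)
        have : Real.exp (-εref * (t - a)) < 1 := Real.exp_lt_one_iff.2 (by nlinarith)
        nlinarith
  have := (le_storage h.pos_γ.le (hφ t ht).1.le _ _).trans (hst t ht)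
  rw [hstart] at this
  exact this.trans (hle t ht)

end

/-! ## The algorithm -/

/-- The strict inequality in the second case matters: a selected candidate exceeds the positive
fall-back interval, so it is not the default value 0. -/
theorem foldl_update_eq {ι : Type*} (g : ι → ℝ) (l : List ι) (h : ℝ) :
    l.foldl (fun h i => if h < g i then g i else h) h = h ∨
      ∃ i ∈ l, l.foldl (fun h i => if h < g i then g i else h) h = g i ∧ h < g i := by
  induction l generalizing h with
  | nil => exact Or.inl rfl
  | cons k l ih =>
    simp only [List.foldl_cons, List.mem_cons]
    split_ifs with hk
    · rcases ih (g k) with h1 | ⟨i, hi, h1, h2⟩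
      · exact Or.inr ⟨k, Or.inl rfl, h1, hk⟩
      · exact Or.inr ⟨i, Or.inr hi, h1, hk.trans h2⟩
    · rcases ih h with h1 | ⟨i, hi, h1, h2⟩
      · exact Or.inl h1
      · exact Or.inr ⟨i, Or.inr hi, h1, h2⟩

theorem intervalLoop_eq {npar : ℕ} [NeZero npar] (δ εref a v C : ℝ) (ε γ L : Fin npar → ℝ) :
    intervalLoop δ εref a v C ε γ L = fallbackInterval δ (ε 0) (γ 0) (L 0) ∨
      ∃ i, i ≠ 0 ∧
        intervalLoop δ εref a v C ε γ L = candidateInterval δ εref a v C (ε i) (γ i) (L i) ∧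
        fallbackInterval δ (ε 0) (γ 0) (L 0) <
          candidateInterval δ εref a v C (ε i) (γ i) (L i) := by
  rcases foldl_update_eq (fun i => candidateInterval δ εref a v C (ε i) (γ i) (L i))
    ((List.finRange npar).filter (fun i => i ≠ 0)) (fallbackInterval δ (ε 0) (γ 0) (L 0))
    with h | ⟨i, hi, h1, h2⟩
  · exact Or.inl h
  · exact Or.inr ⟨i, by simpa using (List.mem_filter.1 hi).2, h1, h2⟩

theorem fallbackInterval_le_intervalLoop {npar : ℕ} [NeZero npar] (δ εref a v C : ℝ)
    (ε γ L : Fin npar → ℝ) :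
    fallbackInterval δ (ε 0) (γ 0) (L 0) ≤ intervalLoop δ εref a v C ε γ L := by
  rcases intervalLoop_eq δ εref a v C ε γ L with h | ⟨i, -, h1, h2⟩
  · exact h.ge
  · rw [h1]; exact h2.le

theorem exists_isLeast_level {nc : ℕ} {c : Fin nc → ℝ} {m : ℝ} (h : ∃ l, m ≤ c l) :
    ∃ l, IsLeast {l | m ≤ c l} l :=
  (toFinite {l | m ≤ c l}).isCompact.exists_isLeast h

theorem clippedIIR_le {X : Type*} {cw cmax : ℝ} (h : cw ≤ cmax) (x : X) (η : ℝ) :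
    clippedIIR cw cmax x η ≤ cmax := max_le (min_le_right _ _) h

/-- The sampling intervals are bounded from below, and between two samples `V` decays to `c_w`
relative to the larger one of `V` and the filter state `η`. -/
structure IsDecayingSampling {X 𝒰 : Type*} [NormedAddCommGroup X] [NormedSpace ℝ X]
    [NormedAddCommGroup 𝒰] (f : X → X → 𝒰 → X) (wbar : ℝ) (V : X → ℝ) (Γ : X → ℝ → ℝ)
    (cw cmax μ tmin : ℝ) : Prop where
  μ_pos : 0 < μ
  tmin_pos : 0 < tmin
  cw_nonneg : 0 ≤ cw
  le_Γ : ∀ x η, V x ≤ cmax → tmin ≤ Γ x η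
  decay : ∀ (w : ℝ → 𝒰) (x e : ℝ → X) (xhat : X) (η a b : ℝ),
    IsFlowSegment f wbar w x e xhat a b → e a = 0 → V xhat ≤ cmax → b - a ≤ Γ xhat η →
    ∀ t ∈ Icc a b, V (x t) ≤ cmax ∧
      V (x t) - cw ≤ Real.exp (-μ * (t - a)) * max (max (V xhat) η - cw) 0

theorem exp_mul_sub_le {cw m ε s : ℝ} (hcw : 0 ≤ cw) (hε : 0 ≤ ε) (hs : 0 ≤ s) :
    Real.exp (-ε * s) * (cw + m) - cw ≤ Real.exp (-ε * s) * m := by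
  have : Real.exp (-ε * s) ≤ 1 := Real.exp_le_one_iff.2 (by nlinarith)
  nlinarith

theorem exp_mul_le_exp_mul {μ ε s m m' : ℝ} (hμ : μ ≤ ε) (hs : 0 ≤ s) (hm : m ≤ m')
    (hm0 : 0 ≤ m) : Real.exp (-ε * s) * m ≤ Real.exp (-μ * s) * m' :=
  mul_le_mul (Real.exp_le_exp.2 (by nlinarith)) hm hm0 (Real.exp_pos _).le

section

variable {X 𝒰 : Type*} [NormedAddCommGroup X] [InnerProductSpace ℝ X] [FiniteDimensional ℝ X]
  [MeasureSpace X] [BorelSpace X] [(volume : Measure X).IsAddHaarMeasure]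
  [NormedAddCommGroup 𝒰] [ProperSpace 𝒰] [MeasurableSpace 𝒰] [BorelSpace 𝒰]

theorem LocalHybridLyapunov.V_nonneg {f : X → X → 𝒰 → X} {wbar c ε γ L : ℝ} {V : X → ℝ}
    {αw : ℝ → ℝ} (h : LocalHybridLyapunov f wbar V αw c ε γ L) (x : X) : 0 ≤ V x := by
  obtain ⟨-, -, -, -, W, H, αWl, αWu, αVl, αVu, -, -, -, -, -, hVl, -, -, hV, -⟩ := h
  refine le_trans ?_ (hV x).1
  rcases (norm_nonneg x).eq_or_lt with h0 | h0
  · rw [← h0, hVl.1.2.2]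
  · exact (hVl.pos h0).le

theorem isDecayingSampling {npar nc : ℕ} [NeZero npar] [NeZero nc] {f : X → X → 𝒰 → X}
    (hf : Continuous fun p : X × X × 𝒰 => f p.1 p.2.1 p.2.2)
    {wbar : ℝ} (hwbar : 0 < wbar) {V : X → ℝ} {αw : ℝ → ℝ} {c : Fin nc → ℝ}
    {ε γ L : Fin npar → Fin nc → ℝ}
    (hLyap : ∀ i l, LocalHybridLyapunov f wbar V αw (c l) (ε i l) (γ i l) (L i l))
    (hε₁ : ∀ l, 0 < ε 0 l) (hε : ∀ i l, i ≠ 0 → ε i l < 0)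
    {cw cmax : ℝ} (hcmax : cw ≤ cmax) (hcw : ∀ l, αw wbar / ε 0 l ≤ cw)
    (hlevel : ∃ l, cmax ≤ c l)
    (htop : (∀ l, c l ≤ cmax) →
      (∀ l, αw wbar / ε 0 l < cmax) ∧ {x | V x ≤ cmax} ⊆ closure {x | V x < cmax})
    {εref δ : ℝ} (hεref : 0 < εref) (hδ₀ : 0 < δ) (hδ₁ : δ < 1) {Γ : X → ℝ → ℝ}
    (hΓ : IsComputedByAlgorithm δ εref (αw wbar) V (clippedIIR cw cmax) c ε γ L Γ) :
    ∃ μ ≤ εref, IsDecayingSampling f wbar V Γ cw cmax μ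
      (⨅ l, δ * Tmax (γ 0 l) (L 0 l + ε 0 l / 2)) := by
  have hA : 0 < αw wbar := (hLyap 0 0).2.2.2.1.pos hwbar
  have hL : ∀ i l, 0 < L i l := fun i l => (hLyap i l).1
  have hcw0 : 0 < cw := (div_pos hA (hε₁ 0)).trans_le (hcw 0)
  obtain ⟨l₀, hl₀⟩ := exists_eq_ciInf_of_finite (f := ε 0)
  have hT : ∀ l, 0 < δ * Tmax (γ 0 l) (L 0 l + ε 0 l / 2) := fun l =>
    mul_pos hδ₀ (Tmax_pos (hLyap 0 l).2.1 (by linarith [hL 0 l, hε₁ l]))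
  have hchoose : ∀ x η, V x ≤ cmax → ∃ l, max (V x) (clippedIIR cw cmax x η) ≤ c l ∧
      Γ x η = intervalLoop δ εref (αw wbar) (V x) (clippedIIR cw cmax x η)
        (fun i => ε i l) (fun i => γ i l) (fun i => L i l) := by
    intro x η hx
    obtain ⟨l, hl⟩ := exists_isLeast_level (c := c) (m := max (V x) (clippedIIR cw cmax x η))
      (hlevel.imp fun l hl => (max_le hx (clippedIIR_le hcmax x η)).trans hl)
    exact ⟨l, hl.1, hΓ x η l hl⟩
  have hfb : ∀ l, ⨅ l, δ * Tmax (γ 0 l) (L 0 l + ε 0 l / 2) ≤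
      fallbackInterval δ (ε 0 l) (γ 0 l) (L 0 l) :=
    fun l => ciInf_le (finite_range _).bddBelow l
  -- The common rate: fall-back intervals contract with ε_{1,l} for some l, the other intervals with
  -- ε_ref.
  refine ⟨min εref (ε 0 l₀), min_le_left _ _, lt_min hεref (hε₁ l₀), ?_, hcw0.le, ?_, ?_⟩
  · obtain ⟨l, hl⟩ := exists_eq_ciInf_of_finite
      (f := fun l => δ * Tmax (γ 0 l) (L 0 l + ε 0 l / 2))
    rw [← hl]; exact hT l
  · intro x η hx
    obtain ⟨l, -, hl⟩ := hchoose x η hx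
    rw [hl]
    exact (hfb l).trans (fallbackInterval_le_intervalLoop δ εref (αw wbar) (V x)
      (clippedIIR cw cmax x η) (fun i => ε i l) (fun i => γ i l) (fun i => L i l))
  · intro w x e xhat η a b hs he hx hb t ht
    have hta : 0 ≤ t - a := by linarith [ht.1]
    obtain ⟨l, hlc, hl⟩ := hchoose xhat η hx
    obtain ⟨hVl, hCl⟩ := max_le_iff.1 hlc
    set C := clippedIIR cw cmax xhat η with hC
    have hcwC : cw ≤ C := le_max_right _ _
    rw [hl] at hb
    rcases intervalLoop_eq δ εref (αw wbar) (V xhat) C (fun i => ε i l) (fun i => γ i l)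
      (fun i => L i l) with h | ⟨i, hi, h1, h2⟩
    · rw [h] at hb
      obtain ⟨W, H, hp⟩ := (hLyap 0 l).exists_lyapunovPair
      have := hp.sub_le_exp_mul hf hs (hε₁ l) (hL 0 l) hδ₁ hb he (hcw l) (hcwC.trans hCl) hVl
        (fun heq => by
          by_cases hex : ∃ l', c l < c l'
          · obtain ⟨l', hl'⟩ := hex
            obtain ⟨W', H', hp'⟩ := (hLyap 0 l').exists_lyapunovPair
            exact Or.inr ⟨_, _, _, _, W', H', hp', hl', hε₁ l', hL 0 l', hcw l'⟩
          -- Without a larger level c_l is maximal, and V(x̂) = c_l ≤ c_max forces c_max = c_l; this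
          -- is the case covered by the hypothesis on the top level.
          · push Not at hex
            obtain ⟨l₁, hl₁⟩ := hlevel
            have hcl : c l = cmax := le_antisymm (heq ▸ hx) (hl₁.trans (hex l₁))
            obtain ⟨h3, h4⟩ := htop (hcl ▸ hex)
            exact Or.inl ⟨hcl ▸ h3 l, hcl ▸ h4 hx⟩) t ht
      constructor
      · have h5 : Real.exp (-ε 0 l * (t - a)) ≤ 1 :=
          Real.exp_le_one_iff.2 (by nlinarith [hε₁ l])
        have h6 : max (V xhat - cw) 0 ≤ cmax - cw := max_le (by linarith) (by linarith)
        have h7 : 0 ≤ max (V xhat - cw) 0 := le_max_right _ _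
        nlinarith
      · refine this.trans (exp_mul_le_exp_mul
          ((min_le_right _ _).trans (hl₀ ▸ ciInf_le (finite_range _).bddBelow l)) hta ?_
          (le_max_right _ _))
        exact max_le_max (by linarith [le_max_left (V xhat) η]) le_rfl
    · rw [h1] at hb
      obtain ⟨W, H, hp⟩ := (hLyap i l).exists_lyapunovPair
      have hpos := (hT l).trans h2
      obtain ⟨-, hle⟩ := hp.le_exp_mul hf hs (hε i l hi) hεref hδ₁ hA ((hLyap i l).V_nonneg xhat)
        he hCl hpos hb
      have hle := hle t ht
      have h5 : Real.exp (-εref * (t - a)) ≤ 1 := Real.exp_le_one_iff.2 (by nlinarith)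
      constructor
      · have := clippedIIR_le hcmax xhat η
        nlinarith
      · have h6 : C ≤ cw + max (max (V xhat) η - cw) 0 := by
          refine max_le ?_ (by linarith [le_max_right (max (V xhat) η - cw) 0])
          have h8 := le_max_left (max (V xhat) η - cw) 0
          have h9 := le_max_right (V xhat) η
          have h10 := min_le_left η cmax
          linarith
        have h7 := mul_le_mul_of_nonneg_left h6 (Real.exp_pos (-εref * (t - a))).le
        have h8 := exp_mul_sub_le (m := max (max (V xhat) η - cw) 0) hcw0.le hεref.le hta
        have h9 := exp_mul_le_exp_mul (min_le_left εref (ε 0 l₀)) hta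
          (le_refl (max (max (V xhat) η - cw) 0)) (le_max_right _ _)
        linarith

end

/-! ## Solutions of the hybrid system -/

theorem IsHybridTimeDomain.exists_times {D : Set (ℝ × ℕ)} (hD : IsHybridTimeDomain D) {T : ℝ}
    {J : ℕ} (h : (T, J) ∈ D) :
    ∃ t : ℕ → ℝ, t 0 = 0 ∧ t (J + 1) = T ∧ (∀ j ≤ J, t j ≤ t (j + 1)) ∧
      ∀ j ≤ J, ∀ s ∈ Icc (t j) (t (j + 1)), (s, j) ∈ D := by
  obtain ⟨J', t, h0, hmono, heq⟩ := hD.2 T J h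
  have hmem : (T, J) ∈ D ∩ Icc 0 T ×ˢ Iic J :=
    ⟨h, ⟨hD.1 _ h, le_rfl⟩, mem_Iic.2 le_rfl⟩
  have hin : ∀ j < J', ∀ s ∈ Icc (t j) (t (j + 1)), (s, j) ∈ D ∩ Icc 0 T ×ˢ Iic J := by
    intro j hj s hs
    rw [heq]
    exact mem_biUnion (mem_Iio.2 hj) ⟨hs, rfl⟩
  rw [heq] at hmem
  simp only [mem_iUnion, mem_prod, mem_singleton_iff] at hmem
  obtain ⟨j, hj, hT, rfl⟩ := hmem
  have hj' : J < J' := hj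
  refine ⟨t, h0, le_antisymm ?_ hT.2, fun j hj => hmono j (hj.trans_lt hj'),
    fun j hj s hs => (hin j (hj.trans_lt hj') s hs).1⟩
  exact (hin J hj' _ (right_mem_Icc.2 (hmono J hj'))).2.1.2

theorem IsHybridTimeDomain.mem_of_mem_Icc {D : Set (ℝ × ℕ)} (hD : IsHybridTimeDomain D) {a b : ℝ}
    {j : ℕ} (ha : (a, j) ∈ D) (hb : (b, j) ∈ D) {s : ℝ} (hs : s ∈ Icc a b) : (s, j) ∈ D := by
  obtain ⟨J', t, -, -, heq⟩ := hD.2 b j hb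
  have hab := hs.1.trans hs.2
  have h1 : (a, j) ∈ D ∩ Icc 0 b ×ˢ Iic j := ⟨ha, ⟨hD.1 _ ha, hab⟩, mem_Iic.2 le_rfl⟩
  have h2 : (b, j) ∈ D ∩ Icc 0 b ×ˢ Iic j := ⟨hb, ⟨hD.1 _ hb, le_rfl⟩, mem_Iic.2 le_rfl⟩
  have h3 : (s, j) ∈ D ∩ Icc 0 b ×ˢ Iic j := by
    rw [heq] at h1 h2 ⊢
    simp only [mem_iUnion, mem_prod, mem_singleton_iff] at h1 h2 ⊢
    obtain ⟨i, hi, hai, rfl⟩ := h1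
    obtain ⟨i', hi', hbi, rfl⟩ := h2
    exact ⟨_, hi, ⟨hai.1.trans hs.1, hs.2.trans hbi.2⟩, rfl⟩
  exact h3.1

theorem AbsolutelyContinuousOnInterval.fst {E F : Type*} [PseudoMetricSpace E]
    [PseudoMetricSpace F] {f : ℝ → E × F} {a b : ℝ} (h : AbsolutelyContinuousOnInterval f a b) :
    AbsolutelyContinuousOnInterval (fun t => (f t).1) a b :=
  LipschitzWith.prod_fst.lipschitzOnWith.comp_absolutelyContinuousOnInterval h (mapsTo_univ _ _)

theorem AbsolutelyContinuousOnInterval.snd {E F : Type*} [PseudoMetricSpace E]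
    [PseudoMetricSpace F] {f : ℝ → E × F} {a b : ℝ} (h : AbsolutelyContinuousOnInterval f a b) :
    AbsolutelyContinuousOnInterval (fun t => (f t).2) a b :=
  LipschitzWith.prod_snd.lipschitzOnWith.comp_absolutelyContinuousOnInterval h (mapsTo_univ _ _)

theorem HasDerivAt.prod_fst {E F : Type*} [NormedAddCommGroup E] [NormedSpace ℝ E]
    [NormedAddCommGroup F] [NormedSpace ℝ F] {f : ℝ → E × F} {f' : E × F} {t : ℝ}
    (h : HasDerivAt f f' t) : HasDerivAt (fun t => (f t).1) f'.1 t :=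
  (ContinuousLinearMap.fst ℝ E F).hasFDerivAt.comp_hasDerivAt t h

theorem HasDerivAt.prod_snd {E F : Type*} [NormedAddCommGroup E] [NormedSpace ℝ E]
    [NormedAddCommGroup F] [NormedSpace ℝ F] {f : ℝ → E × F} {f' : E × F} {t : ℝ}
    (h : HasDerivAt f f' t) : HasDerivAt (fun t => (f t).2) f'.2 t :=
  (ContinuousLinearMap.snd ℝ E F).hasFDerivAt.comp_hasDerivAt t h

/-- An absolutely continuous function is constant if its derivative vanishes almost everywhere. -/
theorem AbsolutelyContinuousOnInterval.eq_left {E : Type*} [NormedAddCommGroup E] [NormedSpace ℝ E]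
    {g : ℝ → E} {a b : ℝ} (hab : a ≤ b) (hg : AbsolutelyContinuousOnInterval g a b)
    (h : ∀ᵐ t, t ∈ Ioo a b → HasDerivAt g 0 t) {t : ℝ} (ht : t ∈ Icc a b) : g t = g a := by
  obtain ⟨C, hC⟩ := hg.const_of_ae_hasDerivAt_zero (by
    have hna : ∀ᵐ t : ℝ, t ≠ a := by simp [ae_iff, measure_singleton]
    have hnb : ∀ᵐ t : ℝ, t ≠ b := by simp [ae_iff, measure_singleton]
    filter_upwards [h, hna, hnb] with t ht h1 h2 hm
    rw [uIcc_of_le hab] at hm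
    exact ht ⟨lt_of_le_of_ne hm.1 (Ne.symm h1), lt_of_le_of_ne hm.2 h2⟩)
  rw [uIcc_of_le hab] at hC
  rw [hC t ht, hC a (left_mem_Icc.2 hab)]

section

variable {X 𝒰 : Type*} [NormedAddCommGroup X] [NormedSpace ℝ X] [NormedAddCommGroup 𝒰]
  {f : X → X → 𝒰 → X} {S : ℝ → X → ℝ} {Γ : X → ℝ → ℝ} {wbar : ℝ} {w : ℝ → 𝒰} {D : Set (ℝ × ℕ)}
  {ξ : ℝ → ℕ → StcState X ℝ} {V : X → ℝ} {cw cmax μ tmin : ℝ}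

/-- The components of a trajectory between two jumps. -/
theorem IsStcTrajectory.flow_interval (h : IsStcTrajectory (stcSystem f S Γ) wbar w D ξ) {a b : ℝ}
    {j : ℕ} (hab : a ≤ b) (ha : (a, j) ∈ D) (hb : (b, j) ∈ D) :
    IsFlowSegment f wbar w (fun t => (ξ t j).x) (fun t => (ξ t j).e)
      ((ξ a j).x + (ξ a j).e) a b ∧
    (ξ b j).η = (ξ a j).η ∧ (ξ b j).τmax = (ξ a j).τmax ∧ (ξ b j).τ = (ξ a j).τ + (b - a) ∧
    (a < b → (ξ a j).τ + (b - a) ≤ (ξ a j).τmax) := by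
  have hsub : ∀ s ∈ Icc a b, (s, j) ∈ D := fun s hs =>
    h.solution.timeDomain.mem_of_mem_Icc ha hb hs
  have ha0 : 0 ≤ a := h.solution.timeDomain.1 _ ha
  have hac := h.solution.absCont j a b hab ha hb
  have hfl : ∀ᵐ t, t ∈ Ioo a b → (ξ t j).τ ≤ (ξ t j).τmax ∧
      HasDerivAt (fun s => ξ s j) ((stcSystem f S Γ).flow (ξ t j) (w t)) t := by
    filter_upwards [h.solution.flows j] with t ht hm
    obtain ⟨h1, h2⟩ := ht (hsub t (Ioo_subset_Icc_self hm))
    exact ⟨h1, (h2.mono hsub).hasDerivAt (Icc_mem_nhds hm.1 hm.2)⟩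
  have hacτ := hac.snd.snd.snd.fst
  have hη : ∀ t ∈ Icc a b, (ξ t j).η = (ξ a j).η := fun t ht =>
    hac.snd.snd.fst.eq_left hab (by
      filter_upwards [hfl] with s hs hm
      exact (hs hm).2.prod_snd.prod_snd.prod_fst) ht
  have hm : ∀ t ∈ Icc a b, (ξ t j).τmax = (ξ a j).τmax := fun t ht =>
    hac.snd.snd.snd.snd.eq_left hab (by
      filter_upwards [hfl] with s hs hm
      exact (hs hm).2.prod_snd.prod_snd.prod_snd.prod_snd) ht
  have hτ : ∀ t ∈ Icc a b, (ξ t j).τ = (ξ a j).τ + (t - a) := fun t ht => by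
    have hid : AbsolutelyContinuousOnInterval (fun s : ℝ => s) a b :=
      contDiffOn_id.absolutelyContinuousOnInterval
    have := (hac.snd.snd.snd.fst.fun_sub hid).eq_left hab (by
      filter_upwards [hfl] with s hs hm
      have := (hs hm).2.prod_snd.prod_snd.prod_snd.prod_fst.sub (hasDerivAt_id s)
      exact this.congr_deriv (sub_self (1 : ℝ))) ht
    have h2 : (ξ t j).τ - t = (ξ a j).τ - a := this
    linarith
  refine ⟨⟨hab, hac.fst, hac.snd.fst, fun t ht => ?_, ?_, ?_, fun t ht =>
    h.bounded t (ha0.trans ht.1)⟩, hη b (right_mem_Icc.2 hab), hm b (right_mem_Icc.2 hab),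
    hτ b (right_mem_Icc.2 hab), fun hlt => ?_⟩
  · exact (hac.fst.fun_add hac.snd.fst).eq_left hab (by
      filter_upwards [hfl] with s hs hm
      have := (hs hm).2.prod_fst.add (hs hm).2.prod_snd.prod_fst
      exact this.congr_deriv (add_neg_cancel _)) ht
  · filter_upwards [hfl] with s hs hm
    exact ⟨(hs hm).2.prod_fst, (hs hm).2.prod_snd.prod_fst⟩
  · exact h.locallyIntegrable.aestronglyMeasurable.mono_measure
      (Measure.restrict_mono (fun t ht => ha0.trans ht.1) le_rfl)
  -- Membership in the flow set is known only for almost every time, but such times are dense and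
  -- would meet the nonempty open interval after the timer has expired.
  · by_contra! hcon
    have hlt' : max a (a + (ξ a j).τmax - (ξ a j).τ) < b := max_lt hlt (by linarith)
    obtain ⟨t, hP, ht⟩ := (Measure.dense_of_ae hfl).exists_mem_open isOpen_Ioo
      (nonempty_Ioo.2 hlt')
    obtain ⟨ht1, ht2⟩ := max_lt_iff.1 ht.1
    have htI : t ∈ Ioo a b := ⟨ht1, ht.2⟩
    have h1 := (hP htI).1
    rw [hτ t (Ioo_subset_Icc_self htI), hm t (Ioo_subset_Icc_self htI)] at h1
    linarith

end

/-! ## Decay along the solutions of the hybrid system -/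

theorem iirUpdate_le {r₁ r₂ cw m η v : ℝ} (hr₁ : 0 < r₁) (hr₂ : 0 < r₂) (hr : r₁ + r₂ ≤ 1)
    (hcm : 0 ≤ cw + m) (hη : η ≤ cw + m) (hv : v ≤ cw + m) : r₁ * η + r₂ * v ≤ cw + m := by
  nlinarith

section

variable {X 𝒰 : Type*} [NormedAddCommGroup X] [NormedSpace ℝ X] [NormedAddCommGroup 𝒰]
  {f : X → X → 𝒰 → X} {Γ : X → ℝ → ℝ} {wbar : ℝ} {w : ℝ → 𝒰} {D : Set (ℝ × ℕ)}
  {ξ : ℝ → ℕ → StcState X ℝ} {V : X → ℝ} {cw cmax μ tmin εref r₁ r₂ : ℝ}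

/-- After the jump at time `a`, a trajectory flows for at most `Γ`, and it decays. -/
theorem IsDecayingSampling.decay_after_jump (hd : IsDecayingSampling f wbar V Γ cw cmax μ tmin)
    (hμ : μ ≤ εref) (hr₁ : 0 < r₁) (hr₂ : 0 < r₂) (hr : r₁ + r₂ ≤ 1)
    (h : IsStcTrajectory (stcSystem f (iirUpdate εref r₁ r₂ V Γ) Γ) wbar w D ξ) {a b : ℝ} {j : ℕ}
    (hab : a ≤ b) (haj : (a, j) ∈ D) (ha : (a, j + 1) ∈ D) (hb : (b, j + 1) ∈ D)
    (hV : V (ξ a j).x ≤ cmax) :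
    V (ξ b (j + 1)).x ≤ cmax ∧
    max (max (V (ξ b (j + 1)).x) (ξ b (j + 1)).η - cw) 0 ≤
      Real.exp (-μ * (b - a)) * max (max (V (ξ a j).x) (ξ a j).η - cw) 0 ∧
    (ξ b (j + 1)).τ = b - a ∧ (ξ b (j + 1)).τmax = Γ (ξ a j).x (ξ a j).η := by
  obtain ⟨-, hj⟩ := h.solution.jumps a j haj ha
  obtain ⟨hs, hη, hτm, hτ, hle⟩ := h.flow_interval hab ha hb
  have he : (ξ a (j + 1)).e = 0 := by rw [hj]; rfl
  have hjx : (ξ a (j + 1)).x = (ξ a j).x := by rw [hj]; rfl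
  have hjη : (ξ a (j + 1)).η = iirUpdate εref r₁ r₂ V Γ (ξ a j).η (ξ a j).x := by rw [hj]; rfl
  have hjτ : (ξ a (j + 1)).τ = 0 := by rw [hj]; rfl
  have hjm : (ξ a (j + 1)).τmax = Γ (ξ a j).x (ξ a j).η := by rw [hj]; rfl
  rw [he, hjx, add_zero] at hs
  rw [hjη] at hη
  rw [hjτ, zero_add] at hτ hle
  rw [hjm] at hτm hle
  have hΓ := hd.le_Γ (ξ a j).x (ξ a j).η hV
  have hba : b - a ≤ Γ (ξ a j).x (ξ a j).η := by
    rcases hab.eq_or_lt with rfl | hlt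
    · linarith [hd.tmin_pos]
    · exact hle hlt
  obtain ⟨h1, h2⟩ := hd.decay w _ _ _ (ξ a j).η a b hs he hV hba b (right_mem_Icc.2 hab)
  set m := max (max (V (ξ a j).x) (ξ a j).η - cw) 0 with hm
  have hm0 : 0 ≤ m := le_max_right _ _
  have hm1 : max (V (ξ a j).x) (ξ a j).η ≤ cw + m := by
    linarith [le_max_left (max (V (ξ a j).x) (ξ a j).η - cw) 0]
  obtain ⟨hm2, hm3⟩ := max_le_iff.1 hm1
  have hcw := hd.cw_nonneg
  have hexp := Real.exp_pos (-μ * (b - a))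
  refine ⟨h1, max_le ?_ (by positivity), hτ, hτm⟩
  rw [sub_le_iff_le_add]
  refine max_le (by linarith) ?_
  rw [hη, iirUpdate]
  have hΓ0 : 0 ≤ Γ (ξ a j).x (ξ a j).η := hd.tmin_pos.le.trans hΓ
  have h3 := mul_le_mul_of_nonneg_left
    (iirUpdate_le hr₁ hr₂ hr (by linarith) hm3 hm2)
    (Real.exp_pos (-εref * Γ (ξ a j).x (ξ a j).η)).le
  -- The new η already carries the factor e^{-ε_ref Γ} for the whole sampling interval; since b - a
  -- ≤ Γ and μ ≤ ε_ref, it meets the required decay at every time b of the interval.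
  have h4 := exp_mul_sub_le (m := m) hcw (hd.μ_pos.le.trans hμ) hΓ0
  have h5 : Real.exp (-εref * Γ (ξ a j).x (ξ a j).η) * m ≤ Real.exp (-μ * (b - a)) * m :=
    mul_le_mul_of_nonneg_right (Real.exp_le_exp.2 (by nlinarith [hd.μ_pos])) hm0
  linarith

/-- Flowing is impossible where the timer has run out. -/
theorem IsStcTrajectory.not_lt_of_jump {S : ℝ → X → ℝ}
    (h : IsStcTrajectory (stcSystem f S Γ) wbar w D ξ) {a b : ℝ} {j : ℕ}
    (ha : (a, j) ∈ D) (hb : (b, j) ∈ D) (hτ : (ξ a j).τ = (ξ a j).τmax) : ¬ a < b := fun hab => by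
  have := (h.flow_interval hab.le ha hb).2.2.2.2 hab
  linarith

/-- Induction over the right endpoints of the flow intervals: the state there determines the next
jump, and the factors e^{-μ(b-a)} multiply up to e^{-μT}. The count J - 1 reflects that the first
jump happens at time 0. -/
theorem IsDecayingSampling.decay_solution (hd : IsDecayingSampling f wbar V Γ cw cmax μ tmin)
    (hμ : μ ≤ εref) (hr₁ : 0 < r₁) (hr₂ : 0 < r₂) (hr : r₁ + r₂ ≤ 1)
    (h : IsStcTrajectory (stcSystem f (iirUpdate εref r₁ r₂ V Γ) Γ) wbar w D ξ)
    (hV : V (ξ 0 0).x ≤ cmax) {T : ℝ} {J : ℕ} (hTJ : (T, J) ∈ D) :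
    V (ξ T J).x ≤ cmax ∧
    max (max (V (ξ T J).x) (ξ T J).η - cw) 0 ≤
      Real.exp (-μ * T) * max (max (V (ξ 0 0).x) (ξ 0 0).η - cw) 0 ∧
    tmin * (J - 1) ≤ T := by
  obtain ⟨t, h0, hT, hmono, hin⟩ := h.solution.timeDomain.exists_times hTJ
  have hl : ∀ j ≤ J, (t j, j) ∈ D := fun j hj => hin j hj _ (left_mem_Icc.2 (hmono j hj))
  have hr' : ∀ j ≤ J, (t (j + 1), j) ∈ D := fun j hj => hin j hj _ (right_mem_Icc.2 (hmono j hj))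
  have key : ∀ j ≤ J, V (ξ (t (j + 1)) j).x ≤ cmax ∧
      max (max (V (ξ (t (j + 1)) j).x) (ξ (t (j + 1)) j).η - cw) 0 ≤
        Real.exp (-μ * t (j + 1)) * max (max (V (ξ 0 0).x) (ξ 0 0).η - cw) 0 ∧
      (j < J → tmin * j ≤ t (j + 1)) := by
    intro j
    induction j with
    | zero =>
      intro _
      -- Initially τ = τ_max, so no flow is possible before the first jump.
      have h1 : t (0 + 1) = 0 := by
        have ha := hl 0 (Nat.zero_le _)
        rw [h0] at ha
        have hle := hmono 0 (Nat.zero_le _)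
        rw [h0] at hle
        exact (hle.eq_or_lt.resolve_right
          (h.not_lt_of_jump ha (hr' 0 (Nat.zero_le _)) h.init_eq.symm)).symm
      rw [h1]
      simp [hV]
    | succ j ih =>
      intro hj
      have hj' : j ≤ J := (Nat.le_succ j).trans hj
      obtain ⟨h1, h2, h3⟩ := ih hj'
      obtain ⟨h4, h5, h6, h7⟩ := hd.decay_after_jump hμ hr₁ hr₂ hr h (hmono _ hj) (hr' j hj')
        (hl _ hj) (hr' _ hj) h1
      refine ⟨h4, ?_, fun hlt => ?_⟩
      · refine h5.trans ((mul_le_mul_of_nonneg_left h2 (Real.exp_pos _).le).trans_eq ?_)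
        rw [← mul_assoc, ← Real.exp_add]
        congr 2
        ring
      -- An interval followed by another jump has run its timer down to the end; the last one may be
      -- cut off at T, hence the restriction to indices below J.
      · have h8 : (ξ (t (j + 1 + 1)) (j + 1)).τ = (ξ (t (j + 1 + 1)) (j + 1)).τmax :=
          (h.solution.jumps _ _ (hr' _ hj) (hl _ hlt)).1
        have h9 := hd.le_Γ (ξ (t (j + 1)) j).x (ξ (t (j + 1)) j).η h1
        have h10 := h3 hj
        push_cast
        linarith
  obtain ⟨h1, h2, -⟩ := key J le_rfl
  rw [hT] at h1 h2
  refine ⟨h1, h2, ?_⟩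
  rw [← hT]
  have h3 := hmono J le_rfl
  have h4 := hd.tmin_pos
  rcases J with _ | i
  · rw [h0] at h3
    push_cast
    linarith
  · have h5 := (key i (Nat.le_succ i)).2.2 (Nat.lt_succ_self i)
    push_cast
    linarith

/-- The time between two jumps is at least `tmin`. -/
theorem IsDecayingSampling.le_sub (hd : IsDecayingSampling f wbar V Γ cw cmax μ tmin)
    (hμ : μ ≤ εref) (hr₁ : 0 < r₁) (hr₂ : 0 < r₂) (hr : r₁ + r₂ ≤ 1)
    (h : IsStcTrajectory (stcSystem f (iirUpdate εref r₁ r₂ V Γ) Γ) wbar w D ξ)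
    (hV : V (ξ 0 0).x ≤ cmax) {t t' : ℝ} {j : ℕ} (h1 : (t, j) ∈ D) (h2 : (t, j + 1) ∈ D)
    (h3 : (t', j + 1) ∈ D) (h4 : (t', j + 2) ∈ D) : tmin ≤ t' - t := by
  have h5 : (ξ t' (j + 1)).τ = (ξ t' (j + 1)).τmax := (h.solution.jumps _ _ h3 h4).1
  have hle : t ≤ t' := not_lt.1 (h.not_lt_of_jump h3 h2 h5)
  have hVt := (hd.decay_solution hμ hr₁ hr₂ hr h hV h1).1
  obtain ⟨-, -, h6, h7⟩ := hd.decay_after_jump hμ hr₁ hr₂ hr h hle h1 h2 h3 hVt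
  have := hd.le_Γ (ξ t j).x (ξ t j).η hVt
  linarith

end

/-! ### The class 𝒦ℒℒ estimate and the theorem. -/

theorem isClassKL_mul_exp (p : ℝ) {k : ℝ} (hk : 0 < k) :
    IsClassKL fun q s => q * Real.exp (p - k * s) := by
  refine ⟨by fun_prop, fun s _ => ⟨by fun_prop, ?_, zero_mul _⟩, fun q hq => ⟨?_, ?_⟩⟩
  · intro u _ v _ huv
    exact mul_lt_mul_of_pos_right huv (Real.exp_pos _)
  · intro u _ v _ huv
    exact mul_le_mul_of_nonneg_left (Real.exp_le_exp.2 (by nlinarith)) hq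
  · have h1 : Tendsto (fun s : ℝ => p - k * s) atTop atBot :=
      tendsto_atBot_add_const_left _ p (tendsto_neg_atTop_atBot.comp
        (tendsto_id.const_mul_atTop hk))
    simpa using (Real.tendsto_exp_atBot.comp h1).const_mul q

theorem isClassKLL_mul_exp (p : ℝ) {k k' : ℝ} (hk : 0 < k) (hk' : 0 < k') :
    IsClassKLL fun q t j => q * Real.exp (p - k * t - k' * j) := by
  refine fun r _ => ⟨isClassKL_mul_exp (p - k * r) hk', ?_⟩
  convert isClassKL_mul_exp (p - k' * r) hk using 5
  ring

theorem IsDecayingSampling.isRAS {X 𝒰 : Type*} [NormedAddCommGroup X] [NormedSpace ℝ X]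
    [NormedAddCommGroup 𝒰] {f : X → X → 𝒰 → X} {Γ : X → ℝ → ℝ} {wbar : ℝ} {V : X → ℝ}
    {cw cmax μ tmin εref r₁ r₂ : ℝ} (hd : IsDecayingSampling f wbar V Γ cw cmax μ tmin)
    (hμ : μ ≤ εref) (hr₁ : 0 < r₁) (hr₂ : 0 < r₂) (hr : r₁ + r₂ ≤ 1) :
    IsRAS (stcSystem f (iirUpdate εref r₁ r₂ V Γ) Γ) wbar V cw cmax := by
  have hμ0 := hd.μ_pos
  have ht0 := hd.tmin_pos
  -- Half of the rate μ is kept for t; the other half is converted through t_min (j - 1) ≤ t into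
  -- decay in j. The constant μ t_min / 2 pays for the jump at time 0.
  refine ⟨fun q t j => q * Real.exp (μ / 2 * tmin - μ / 2 * t - μ / 2 * tmin * j),
    isClassKLL_mul_exp _ (by positivity) (by positivity), fun w D ξ h hV T J hTJ => ?_⟩
  obtain ⟨-, h1, h2⟩ := hd.decay_solution hμ hr₁ hr₂ hr h hV hTJ
  have h3 : V (ξ T J).x - cw ≤ max (max (V (ξ T J).x) (ξ T J).η - cw) 0 :=
    le_max_of_le_left (by linarith [le_max_left (V (ξ T J).x) (ξ T J).η])
  have h4 : Real.exp (-μ * T) ≤ Real.exp (μ / 2 * tmin - μ / 2 * T - μ / 2 * tmin * J) :=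
    Real.exp_le_exp.2 (by nlinarith)
  have h5 : max (max (V (ξ 0 0).x) (ξ 0 0).η - cw) 0 ≤
      max (V (ξ 0 0).x - cw) 0 + √(‖(ξ 0 0).e‖ ^ 2 + ‖(ξ 0 0).η‖ ^ 2) := by
    have h6 : (ξ 0 0).η ≤ √(‖(ξ 0 0).e‖ ^ 2 + ‖(ξ 0 0).η‖ ^ 2) :=
      Real.le_sqrt_of_sq_le (by rw [Real.norm_eq_abs, sq_abs]; nlinarith [sq_nonneg ‖(ξ 0 0).e‖])
    have h7 := Real.sqrt_nonneg (‖(ξ 0 0).e‖ ^ 2 + ‖(ξ 0 0).η‖ ^ 2)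
    have h8 := le_max_left (V (ξ 0 0).x - cw) 0
    have h9 := le_max_right (V (ξ 0 0).x - cw) 0
    have h10 := hd.cw_nonneg
    refine max_le ?_ (by positivity)
    rw [sub_le_iff_le_add]
    exact max_le (by linarith) (by linarith)
  have h6 := mul_le_mul h5 h4 (Real.exp_pos _).le (by positivity)
  linarith

theorem theorem5 {np nk nu nw npar nc : ℕ} [NeZero npar] [NeZero nc]
    -- plant and controller
    (fp : Vec np → Vec nu → Vec nw → Vec np)
    (fc : Vec nk → Vec np → Vec nk) (gc : Vec nk → Vec np → Vec nu)
    (hf : Continuous fun p : Stacked np nk × Stacked np nk × Vec nw =>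
      closedLoop fp fc gc p.1 p.2.1 p.2.2)
    -- the disturbance bound and the local Lyapunov conditions
    (wbar : ℝ) (hwbar : 0 < wbar)
    (V : Stacked np nk → ℝ) (αw : ℝ → ℝ)
    (c : Fin nc → ℝ) (hc : ∀ l, 0 < c l)
    (ε γ L : Fin npar → Fin nc → ℝ)
    (hLyap : ∀ i l, LocalHybridLyapunov (closedLoop fp fc gc) wbar V αw
      (c l) (ε i l) (γ i l) (L i l))
    (hε₁ : ∀ l, 0 < ε 0 l) (hε : ∀ i l, i ≠ 0 → ε i l < 0)
    -- the levels
    (cw cmax : ℝ) (hcmax : cw ≤ cmax) (hcw : ∀ l, αw wbar / ε 0 l ≤ cw)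
    (hlevel : ∃ l, cmax ≤ c l)
    (htop : (∀ l, c l ≤ cmax) →
      (∀ l, αw wbar / ε 0 l < cmax) ∧ {x | V x ≤ cmax} ⊆ closure {x | V x < cmax})
    -- the mechanism
    (εref δ r₁ r₂ : ℝ) (hεref : 0 < εref) (hδ₀ : 0 < δ) (hδ₁ : δ < 1)
    (hr₁ : 0 < r₁) (hr₂ : 0 < r₂) (hr : r₁ + r₂ ≤ 1)
    (Γ : Stacked np nk → ℝ → ℝ)
    (hΓ : IsComputedByAlgorithm δ εref (αw wbar) V (clippedIIR cw cmax) c ε γ L Γ) :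
    let sys := stcSystem (closedLoop fp fc gc) (iirUpdate εref r₁ r₂ V Γ) Γ
    let tmin := ⨅ l, δ * Tmax (γ 0 l) (L 0 l + ε 0 l / 2)
    0 < tmin ∧
    (∀ x η, (∃ l, max (V x) (clippedIIR cw cmax x η) ≤ c l) → tmin ≤ Γ x η) ∧
    (∀ (w : ℝ → Vec nw) (D : Set (ℝ × ℕ)) (ξ : ℝ → ℕ → StcState (Stacked np nk) ℝ),
      IsStcTrajectory sys wbar w D ξ → V (ξ 0 0).x ≤ cmax →
      ∀ (t t' : ℝ) (j : ℕ), (t, j) ∈ D → (t, j + 1) ∈ D → (t', j + 1) ∈ D → (t', j + 2) ∈ D →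
        tmin ≤ t' - t) ∧
    IsRAS sys wbar V cw cmax := by
  intro sys tmin
  obtain ⟨μ, hμ, hd⟩ := isDecayingSampling hf hwbar hLyap hε₁ hε hcmax hcw hlevel htop hεref hδ₀
    hδ₁ hΓ
  refine ⟨hd.tmin_pos, fun x η hx => ?_, fun w D ξ h hV t t' j h1 h2 h3 h4 =>
    hd.le_sub hμ hr₁ hr₂ hr h hV h1 h2 h3 h4, hd.isRAS hμ hr₁ hr₂ hr⟩
  obtain ⟨l, hl⟩ := exists_isLeast_level hx
  rw [hΓ x η l hl]
  exact (ciInf_le (finite_range _).bddBelow l).trans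
    (fallbackInterval_le_intervalLoop δ εref (αw wbar) (V x) (clippedIIR cw cmax x η)
      (fun i => ε i l) (fun i => γ i l) (fun i => L i l))
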